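/- Let $\Omega\subset\mathbb C$ be a bounded open set. For $1\le p<\infty$ and an open set $U$, let $\mathcal{O}L^p(U)$ be the space of holomorphic $f:U\to\mathbb C$ with $\|f\|_p=\big(\int_U|f|^p\,dv\big)^{1/p}<\infty$ ($dv$ is Lebesgue measure), and let $\mathcal{O}L^\infty(U)$ be the space of bounded holomorphic functions on $U$. For $1<q\le\infty$ the space $\bigcap_{p<q}\mathcal{O}L^p(\Omega)$ (intersection over $1\le p<q$) carries the metric $$d(f,g)=\sum_{j=1}^\infty \frac1{2^j}\,\frac{\|f-g\|_{p_j}}{1+\|f-g\|_{p_j}},$$ where $1<p_1<p_2<\cdots<q$ is any sequence with $p_j\to q$ (the topology does not depend on its choice). A holomorphic function $f:\Omega\to\mathbb C$ is called totally unbounded in $\Omega$ if for every $w\in\partial\Omega$, every $\delta>0$ and every connected component $E$ of $B(w,\delta)\cap\Omega$ one has $\sup_{E}|f|=\infty$. (i) For every bounded open set $\Omega\subset\mathbb C$, the set of functions $g\in\bigcap_{p<2}\mathcal{O}L^p(\Omega)$ which are totally unbounded in $\Omega$ is dense and $G_\delta$ in the space $\bigcap_{p<2}\mathcal{O}L^p(\Omega)$.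 (ii) Let $\Omega\subset\mathbb C$ be a bounded open set such that for every $\zeta\in\partial\Omega$ the connected component of $\mathbb C\setminus\Omega$ which contains $\zeta$ contains at least one more point. Then for every $q$ with $1<q<\infty$, the set of functions $g\in\bigcap_{p<q}\mathcal{O}L^p(\Omega)$ which are totally unbounded in $\Omega$ is dense and $G_\delta$ in the space $\bigcap_{p<q}\mathcal{O}L^p(\Omega)$. (iii) Let $\Omega\subset\mathbb C$ be a bounded open set with $C^1$ boundary (each boundary point has an open neighbourhood $U$ and a real $C^1$ function $\rho$ on $U$ with $d\rho\neq0$ on $U$ and $\Omega\cap U=\{z\in U:\rho(z)<0\}$), and let $1<q\le\infty$. Then the set of functions $g\in\bigcap_{p<q}\mathcal{O}L^p(\Omega)$ which are totally unbounded in $\Omega$ and satisfy $g\notin\mathcal{O}L^q(B(\zeta,\varepsilon)\cap\Omega)$ for all $\zeta\in\partial\Omega$ and all $\varepsilon>0$ is dense and $G_\delta$ in the space $\bigcap_{p<q}\mathcal{O}L^p(\Omega)$. -/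

import Mathlib

open MeasureTheory Filter Topology TopologicalSpace
open scoped ENNReal

noncomputable section

/-- `f ∈ OL^p(U)` (more precisely: the restriction of `f` to `U` lies in this space): `f` is
holomorphic on the open set `U` and `∫_U |f|^p < ∞` (Lebesgue measure).
For `p = ∞` this says that `f` is holomorphic and bounded on `U`: the essential supremum of a
continuous function on an open set is its supremum. -/
def MemBergman (p : ℝ≥0∞) (U : Set ℂ) (f : ℂ → ℂ) : Prop :=
  DifferentiableOn ℂ f U ∧ MemLp f p (volume.restrict U)

/-- A holomorphic function on `Ω` is totally unbounded if it is unbounded on every connected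
component of `B(w, δ) ∩ Ω`, for every `w ∈ ∂Ω` and every `δ > 0`. -/
def TotallyUnbounded (Ω : Set ℂ) (f : ℂ → ℂ) : Prop :=
  ∀ w ∈ frontier Ω, ∀ δ : ℝ, 0 < δ → ∀ c ∈ Metric.ball w δ ∩ Ω,
    ¬ BddAbove ((fun z => ‖f z‖) '' connectedComponentIn (Metric.ball w δ ∩ Ω) c)

/-- `f` is not in `OL^q(B(ζ, ε) ∩ Ω)` for any `ζ ∈ ∂Ω` and any `ε > 0`. -/
def NowhereLocallyBergman (q : ℝ≥0∞) (Ω : Set ℂ) (f : ℂ → ℂ) : Prop :=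
  ∀ ζ ∈ frontier Ω, ∀ ε : ℝ, 0 < ε → ¬ MemBergman q (Metric.ball ζ ε ∩ Ω) f

/-- The open set `Ω` has `C^1` boundary: near each boundary point, `Ω` is `{ρ < 0}` for
a real-valued `C^1` function `ρ` with non-vanishing differential. -/
def HasC1Boundary (Ω : Set ℂ) : Prop :=
  ∀ ζ ∈ frontier Ω, ∃ (U : Set ℂ) (ρ : ℂ → ℝ), IsOpen U ∧ ζ ∈ U ∧ ContDiffOn ℝ 1 ρ U ∧
    (∀ z ∈ U, fderiv ℝ ρ z ≠ 0) ∧ Ω ∩ U = {z ∈ U | ρ z < 0}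

/-- A sequence of exponents `1 < p_0 < p_1 < ⋯ < q` with `p_j → q`. -/
structure ExponentSeq (q : ℝ≥0∞) where
  /-- The exponents. -/
  exponent : ℕ → ℝ≥0∞
  strictMono : StrictMono exponent
  one_lt : ∀ j, 1 < exponent j
  lt : ∀ j, exponent j < q
  tendsto : Tendsto exponent atTop (𝓝 q)

/-- The space `⋂_{1 ≤ p < q} OL^p(Ω)`. A function `Ω → ℂ` is represented by its extension
by zero to `ℂ`. The set of elements does not depend on the sequence `P`,
which enters only through the metric below. -/
structure BergmanInter (Ω : Opens ℂ) {q : ℝ≥0∞} (P : ExponentSeq q) where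
  /-- The underlying function. -/
  toFun : ℂ → ℂ
  memBergman : ∀ p : ℝ≥0∞, 1 ≤ p → p < q → MemBergman p (Ω : Set ℂ) toFun
  eq_zero : ∀ z ∉ Ω, toFun z = 0

namespace BergmanInter

variable {Ω : Opens ℂ} {q : ℝ≥0∞} {P : ExponentSeq q}

instance : CoeFun (BergmanInter Ω P) (fun _ => ℂ → ℂ) := ⟨toFun⟩

/-- The norm distance `‖f - g‖_p = (∫_Ω |f - g|^p)^(1/p)`. -/
def normDist (p : ℝ≥0∞) (f g : BergmanInter Ω P) : ℝ :=
  (eLpNorm (fun z => f z - g z) p (volume.restrict (Ω : Set ℂ))).toReal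

/-- The `j`-th summand (`j = 0, 1, 2, …`) of the metric. -/
def distTerm (f g : BergmanInter Ω P) (j : ℕ) : ℝ :=
  1 / 2 ^ (j + 1) * (normDist (P.exponent j) f g / (1 + normDist (P.exponent j) f g))

theorem normDist_nonneg (p : ℝ≥0∞) (f g : BergmanInter Ω P) : 0 ≤ normDist p f g :=
  ENNReal.toReal_nonneg

theorem memLp (f : BergmanInter Ω P) (j : ℕ) :
    MemLp f (P.exponent j) (volume.restrict (Ω : Set ℂ)) :=
  (f.memBergman _ (P.one_lt j).le (P.lt j)).2

theorem normDist_comm (p : ℝ≥0∞) (f g : BergmanInter Ω P) :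
    normDist p f g = normDist p g f := by
  unfold normDist
  congr 1
  exact eLpNorm_sub_comm f.toFun g.toFun p _

theorem normDist_triangle (f g h : BergmanInter Ω P) (j : ℕ) :
    normDist (P.exponent j) f h ≤
      normDist (P.exponent j) f g + normDist (P.exponent j) g h := by
  have hfg := (f.memLp j).sub (g.memLp j)
  have hgh := (g.memLp j).sub (h.memLp j)
  have key := eLpNorm_add_le hfg.1 hgh.1 (P.one_lt j).le
  rw [sub_add_sub_cancel] at key
  have h2 := ENNReal.toReal_mono (ENNReal.add_ne_top.2 ⟨hfg.2.ne, hgh.2.ne⟩) key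
  rwa [ENNReal.toReal_add hfg.2.ne hgh.2.ne] at h2

theorem distTerm_nonneg (f g : BergmanInter Ω P) (j : ℕ) : 0 ≤ distTerm f g j := by
  have := normDist_nonneg (P.exponent j) f g
  unfold distTerm
  positivity

theorem distTerm_summable (f g : BergmanInter Ω P) : Summable (distTerm f g) := by
  refine Summable.of_nonneg_of_le (distTerm_nonneg f g) (fun j => ?_)
    ((summable_nat_add_iff 1).2 summable_geometric_two)
  have h0 := normDist_nonneg (P.exponent j) f g
  have h1 : normDist (P.exponent j) f g / (1 + normDist (P.exponent j) f g) ≤ 1 := by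
    rw [div_le_one (by positivity)]
    linarith
  unfold distTerm
  rw [one_div_pow]
  exact mul_le_of_le_one_right (by positivity) h1

theorem distTerm_triangle (f g h : BergmanInter Ω P) (j : ℕ) :
    distTerm f h j ≤ distTerm f g j + distTerm g h j := by
  have ha := normDist_nonneg (P.exponent j) f g
  have hb := normDist_nonneg (P.exponent j) g h
  have hc := normDist_nonneg (P.exponent j) f h
  have ht := normDist_triangle f g h j
  unfold distTerm
  rw [← mul_add]
  refine mul_le_mul_of_nonneg_left ?_ (by positivity)
  generalize normDist (P.exponent j) f g = a at *
  generalize normDist (P.exponent j) g h = b at *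
  generalize normDist (P.exponent j) f h = c at *
  rw [div_add_div _ _ (by positivity) (by positivity), div_le_div_iff₀ (by positivity)
    (by positivity)]
  nlinarith [mul_nonneg ha hb, mul_nonneg (mul_nonneg ha hb) hc]

theorem eq_of_tsum_eq_zero (f g : BergmanInter Ω P) (h : ∑' j, distTerm f g j = 0) : f = g := by
  have hle : distTerm f g 0 ≤ 0 :=
    h ▸ (distTerm_summable f g).le_tsum 0 (fun j _ => distTerm_nonneg f g j)
  have h0 : distTerm f g 0 = 0 := le_antisymm hle (distTerm_nonneg f g 0)
  have hn := normDist_nonneg (P.exponent 0) f g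
  have hN : normDist (P.exponent 0) f g = 0 := by
    unfold distTerm at h0
    rcases mul_eq_zero.1 h0 with h1 | h1
    · norm_num at h1
    · rcases div_eq_zero_iff.1 h1 with h2 | h2
      · exact h2
      · linarith
  have hm := (f.memLp 0).sub (g.memLp 0)
  have hz : eLpNorm (f.toFun - g.toFun) (P.exponent 0) (volume.restrict (Ω : Set ℂ)) = 0 :=
    ((ENNReal.toReal_eq_zero_iff _).1 hN).resolve_right hm.2.ne
  have hp : P.exponent 0 ≠ 0 := (zero_lt_one.trans (P.one_lt 0)).ne'
  have hae : f.toFun =ᵐ[volume.restrict (Ω : Set ℂ)] g.toFun :=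
    ((eLpNorm_eq_zero_iff hm.1 hp).1 hz).mono (fun z hz => sub_eq_zero.1 hz)
  have hd : ∀ u : BergmanInter Ω P, ContinuousOn u.toFun Ω := fun u =>
    (u.memBergman _ (P.one_lt 0).le (P.lt 0)).1.continuousOn
  have heq := Measure.eqOn_open_of_ae_eq hae Ω.isOpen (hd f) (hd g)
  have hfun : f.toFun = g.toFun := by
    funext z
    by_cases hz : z ∈ Ω
    · exact heq hz
    · rw [f.eq_zero z hz, g.eq_zero z hz]
  cases f
  cases g
  simpa using hfun

/-- The space `⋂_{1 ≤ p < q} OL^p(Ω)` with the metric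
`d(f, g) = ∑_j 2^(-j) ‖f - g‖_{p_j} / (1 + ‖f - g‖_{p_j})`. -/
instance : MetricSpace (BergmanInter Ω P) where
  dist f g := ∑' j, distTerm f g j
  dist_self f := by simp [distTerm, normDist]
  dist_comm f g := by simp only [distTerm, normDist_comm]
  dist_triangle f g h := by
    rw [← (distTerm_summable f g).tsum_add (distTerm_summable g h)]
    exact (distTerm_summable f h).tsum_le_tsum (distTerm_triangle f g h)
      ((distTerm_summable f g).add (distTerm_summable g h))
  eq_of_dist_eq_zero := fun {f g} h => eq_of_tsum_eq_zero f g h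

end BergmanInter

end

/-! This is a Baire category argument. For bounded `Ω` the space is complete, since point
evaluations are locally uniformly controlled by `L^p` norms. Each property in question is a
countable intersection of conditions `g ∉ L^r(E)` with `E ⊆ Ω` open. Total unboundedness takes `r =
∞` and for `E` components of `V ∩ Ω`; failure of local `L^q` integrability takes `r = q` and `E = V
∩ Ω`; in both cases `V` runs over countably many balls.

Each single condition defines a `G_δ` set, because the sets `‖g‖_{L^r(E)} ≤ n` are closed by Fatou's
lemma. It is dense as soon as one `h` in the space satisfies it: if `f ∈ L^r(E)`, then `f + c h ∉
L^r(E)` for all `c ≠ 0`, and `f + c h → f` as `c → 0` (`dense_isGδ_not_memLp`).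

It remains to find, for each `w ∈ ∂Ω`, a function of the space that is singular at `w`. For (i) it
is `1 / (z - w)`. For finite `q` in (ii) and (iii) it is a branch of `((z - ζ) / (z - w)) ^ (2 /
q)`, where `ζ ≠ w` lies in the component of `Ωᶜ` containing `w`; the exponent is critical, so `L^p`
holds for `p < q` and `L^q` fails on any cone at `w`. For `q = ∞` in (iii) it is `log ((z - w) / (z
- ζ))` with a segment `[w, ζ]` outside `Ω`. Blow-up at boundary points suffices for total
unboundedness because every component of `V ∩ Ω` with `V ⊄ Ω` accumulates at a point of `∂Ω` in `V`.
-/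

noncomputable section

/-! ### Mean value inequalities and point evaluations -/

/-- The mean value inequality on a circle, with a lower Lebesgue integral. -/
theorem two_pi_mul_enorm_le_lintegral_circleMap {f : ℂ → ℂ} {z : ℂ} {r : ℝ} (hr : 0 < r)
    (hf : DiffContOnCl ℂ f (Metric.ball z r)) :
    ENNReal.ofReal (2 * Real.pi) * ‖f z‖ₑ ≤
      ∫⁻ θ in Set.Ioo (-Real.pi) Real.pi, ‖f (circleMap z r θ)‖ₑ := by
  have h1 : Real.circleAverage f z r = f z := by
    apply DiffContOnCl.circleAverage
    rwa [abs_of_pos hr]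
  have h2 : (∫ θ in (-Real.pi)..Real.pi, f (circleMap z r θ)) = (2 * Real.pi) • f z := by
    -- Circle averages are taken over `(0, 2π)`, polar coordinates over `(-π, π)`; periodicity
    -- passes from one to the other.
    have hper : Function.Periodic (fun θ => f (circleMap z r θ)) (2 * Real.pi) :=
      fun θ => by simp only [periodic_circleMap z r θ]
    have := hper.intervalIntegral_add_eq (-Real.pi) 0
    rw [show -Real.pi + 2 * Real.pi = Real.pi by ring, zero_add] at this
    rw [this, ← h1, Real.circleAverage_def, smul_smul, mul_inv_cancel₀ (by positivity), one_smul]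
  rw [intervalIntegral.integral_of_le (by linarith [Real.pi_pos]), integral_Ioc_eq_integral_Ioo]
    at h2
  have h3 := enorm_integral_le_lintegral_enorm (μ := volume.restrict (Set.Ioo (-Real.pi) Real.pi))
    (fun θ => f (circleMap z r θ))
  rw [h2, enorm_smul] at h3
  rwa [Real.enorm_eq_ofReal (by positivity)] at h3

/-- The mean value inequality on a disc. -/
theorem enorm_le_mul_lintegral_ball {f : ℂ → ℂ} {z : ℂ} {R : ℝ} (hR : 0 < R)
    (hf : DiffContOnCl ℂ f (Metric.ball z R)) :
    ENNReal.ofReal (R / 2) * (ENNReal.ofReal (R / 2) * (ENNReal.ofReal (2 * Real.pi) * ‖f z‖ₑ)) ≤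
      ∫⁻ x in Metric.ball z R, ‖f x‖ₑ := by
  have hcont : ContinuousOn f (Metric.ball z R) := hf.continuousOn_ball.mono Metric.ball_subset_closedBall
  set F : ℂ → ℝ≥0∞ := (Metric.ball z R).indicator (fun x => ‖f x‖ₑ) with hF
  have hFm : Measurable F := by
    classical
    have := ContinuousOn.measurable_piecewise (s := Metric.ball z R) (f := fun x => ‖f x‖ₑ)
      (g := fun _ => 0) hcont.enorm continuousOn_const Metric.isOpen_ball.measurableSet
    rwa [hF, ← Set.piecewise_eq_indicator]
  rw [← lintegral_indicator Metric.isOpen_ball.measurableSet, ← hF,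
    ← lintegral_add_left_eq_self F z, ← Complex.lintegral_comp_polarCoord_symm]
  have hprod : volume.restrict polarCoord.target =
      (volume.restrict (Set.Ioi (0 : ℝ))).prod (volume.restrict (Set.Ioo (-Real.pi) Real.pi)) := by
    rw [polarCoord_target, Measure.volume_eq_prod, Measure.prod_restrict]
  have hsymm : ∀ p : ℝ × ℝ, z + Complex.polarCoord.symm p = circleMap z p.1 p.2 := by
    intro p
    rw [Complex.polarCoord_symm_apply, circleMap, Complex.exp_mul_I]
    push_cast
    ring
  simp_rw [hsymm]
  have hmeas : Measurable fun p : ℝ × ℝ => ENNReal.ofReal p.1 • F (circleMap z p.1 p.2) := by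
    refine Measurable.mul (by fun_prop) (hFm.comp ?_)
    unfold circleMap
    fun_prop
  rw [hprod, lintegral_prod _ hmeas.aemeasurable]
  -- Only the radii in `(R/2, R)` are kept: there the Jacobian `r` is at least `R/2`, and the
  -- interval has length `R/2`, whence the two factors.
  have hsub : Set.Ioo (R / 2) R ⊆ Set.Ioi 0 := fun r hr => lt_trans (by positivity) hr.1
  refine le_trans ?_ (lintegral_mono_set hsub)
  have hvol : ENNReal.ofReal (R / 2) = volume (Set.Ioo (R / 2) R) := by
    rw [Real.volume_Ioo]; congr 1; ring
  conv_lhs => rw [hvol, mul_comm]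
  rw [← setLIntegral_const]
  refine setLIntegral_mono' measurableSet_Ioo fun r hr => ?_
  have hr0 : 0 < r := hsub hr
  simp only [smul_eq_mul]
  rw [lintegral_const_mul' _ _ ENNReal.ofReal_ne_top]
  gcongr
  · rw [← hvol]
    exact ENNReal.ofReal_le_ofReal hr.1.le
  · have hmem : ∀ θ, circleMap z r θ ∈ Metric.ball z R := fun θ => by
      rw [Metric.mem_ball, dist_eq_norm, circleMap_sub_center, norm_circleMap_zero, abs_of_pos hr0]
      exact hr.2
    simp only [hF, Set.indicator_of_mem (hmem _)]
    exact two_pi_mul_enorm_le_lintegral_circleMap hr0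
      (hf.mono (Metric.ball_subset_ball hr.2.le))

/-- Local uniform bound for point evaluations by an `L^p` norm. -/
theorem exists_enorm_le_mul_eLpNorm {U : Set ℂ} (hU : IsOpen U) (hb : Bornology.IsBounded U)
    {p : ℝ≥0∞} (hp : 1 ≤ p) {z₀ : ℂ} (hz₀ : z₀ ∈ U) :
    ∃ R > 0, ∃ C : ℝ≥0∞, C ≠ ∞ ∧ Metric.ball z₀ R ⊆ U ∧ ∀ f : ℂ → ℂ, DifferentiableOn ℂ f U →
      ∀ z ∈ Metric.ball z₀ R, ‖f z‖ₑ ≤ C * eLpNorm f p (volume.restrict U) := by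
  obtain ⟨r, hr, hrU⟩ := Metric.isOpen_iff.1 hU z₀ hz₀
  set R := r / 3 with hR
  have hR0 : 0 < R := by positivity
  set c := ENNReal.ofReal (R / 2) * (ENNReal.ofReal (R / 2) * (ENNReal.ofReal (2 * Real.pi)))
  have hc0 : c ≠ 0 := by
    have := Real.pi_pos
    simp only [c, ne_eq, mul_eq_zero, ENNReal.ofReal_eq_zero, not_or, not_le]
    refine ⟨by positivity, by positivity, by positivity⟩
  have hct : c ≠ ∞ := by
    simp only [c]
    exact ENNReal.mul_ne_top ENNReal.ofReal_ne_top
      (ENNReal.mul_ne_top ENNReal.ofReal_ne_top ENNReal.ofReal_ne_top)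
  -- The Hölder factor `|U|^(1 - 1/p)`. For `p = ∞` the convention `∞.toReal = 0` gives the correct
  -- exponent 1.
  set V := (volume.restrict U) Set.univ ^ (1 / (1 : ℝ≥0∞).toReal - 1 / p.toReal) with hV
  have hVt : V ≠ ∞ := by
    refine ENNReal.rpow_ne_top_of_nonneg ?_ ?_
    · rcases eq_or_ne p ∞ with rfl | hpt
      · simp
      · have : 1 ≤ p.toReal := by simpa using ENNReal.toReal_mono hpt hp
        simp only [ENNReal.toReal_one, div_one, sub_nonneg]
        rw [div_le_one (by linarith)]
        exact this
    · rw [Measure.restrict_apply_univ]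
      exact hb.measure_lt_top.ne
  refine ⟨R, hR0, c⁻¹ * V, ENNReal.mul_ne_top (ENNReal.inv_ne_top.2 hc0) hVt,
    (Metric.ball_subset_ball (by linarith)).trans hrU, fun f hf z hz => ?_⟩
  have hsub : Metric.closedBall z R ⊆ U := fun x hx => hrU <| by
    have h1 := Metric.mem_closedBall.1 hx
    have h2 := Metric.mem_ball.1 hz
    have := dist_triangle x z z₀
    rw [Metric.mem_ball]
    linarith
  have hd : DiffContOnCl ℂ f (Metric.ball z R) := by
    refine DifferentiableOn.diffContOnCl (hf.mono ?_)
    rwa [closure_ball _ hR0.ne']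
  have h1 := enorm_le_mul_lintegral_ball hR0 hd
  have h2 : ∫⁻ x in Metric.ball z R, ‖f x‖ₑ ≤ eLpNorm f p (volume.restrict U) * V := by
    refine (lintegral_mono_set (Metric.ball_subset_closedBall.trans hsub)).trans ?_
    rw [← eLpNorm_one_eq_lintegral_enorm]
    exact eLpNorm_le_eLpNorm_mul_rpow_measure_univ hp
      (hf.continuousOn.aestronglyMeasurable hU.measurableSet)
  have h3 : c * ‖f z‖ₑ ≤ eLpNorm f p (volume.restrict U) * V := by
    simpa only [c, mul_assoc] using h1.trans h2
  calc ‖f z‖ₑ = c⁻¹ * (c * ‖f z‖ₑ) := by rw [← mul_assoc, ENNReal.inv_mul_cancel hc0 hct, one_mul]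
    _ ≤ c⁻¹ * (eLpNorm f p (volume.restrict U) * V) := by gcongr
    _ = _ := by ring

/-! ### Convergence and completeness in the intersection space -/

namespace BergmanInter

variable {Ω : Opens ℂ} {q : ℝ≥0∞} {P : ExponentSeq q}

theorem differentiableOn (f : BergmanInter Ω P) : DifferentiableOn ℂ f Ω :=
  (f.memBergman _ (P.one_lt 0).le (P.lt 0)).1

theorem eLpNorm_sub_ne_top (f g : BergmanInter Ω P) (j : ℕ) :
    eLpNorm (fun z => f z - g z) (P.exponent j) (volume.restrict (Ω : Set ℂ)) ≠ ∞ :=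
  ((f.memLp j).sub (g.memLp j)).2.ne

theorem ofReal_normDist (f g : BergmanInter Ω P) (j : ℕ) :
    ENNReal.ofReal (normDist (P.exponent j) f g) =
      eLpNorm (fun z => f z - g z) (P.exponent j) (volume.restrict (Ω : Set ℂ)) :=
  ENNReal.ofReal_toReal (eLpNorm_sub_ne_top f g j)

theorem exists_dist_lt_imp_normDist_lt (Ω : Opens ℂ) (P : ExponentSeq q) (j : ℕ) {ε : ℝ}
    (hε : 0 < ε) : ∃ δ > 0, ∀ f g : BergmanInter Ω P, dist f g < δ →
      normDist (P.exponent j) f g < ε := by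
  -- This is the `j`-th summand when the norm distance equals `ε`; `x / (1 + x)` is increasing.
  refine ⟨1 / 2 ^ (j + 1) * (ε / (1 + ε)), by positivity, fun f g h => ?_⟩
  have h1 : distTerm f g j < 1 / 2 ^ (j + 1) * (ε / (1 + ε)) :=
    ((distTerm_summable f g).le_tsum j fun i _ => distTerm_nonneg f g i).trans_lt h
  have h2 := lt_of_mul_lt_mul_left h1 (by positivity)
  have h0 := normDist_nonneg (P.exponent j) f g
  rw [div_lt_div_iff₀ (by positivity) (by positivity)] at h2
  nlinarith

theorem tendsto_of_normDist {ι : Type*} {l : Filter ι} {u : ι → BergmanInter Ω P}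
    {g : BergmanInter Ω P} (h : ∀ j, Tendsto (fun i => normDist (P.exponent j) (u i) g) l (𝓝 0)) :
    Tendsto u l (𝓝 g) := by
  rw [tendsto_iff_dist_tendsto_zero]
  have hs : Summable fun j : ℕ => (1 / 2 : ℝ) ^ (j + 1) :=
    (summable_nat_add_iff 1).2 summable_geometric_two
  have := tendsto_tsum_of_dominated_convergence (𝓕 := l) (f := fun i j => distTerm (u i) g j)
    (g := fun _ => 0) hs (fun j => ?_) (Eventually.of_forall fun i j => ?_)
  · rwa [tsum_zero] at this
  · have h1 := ((h j).div ((h j).const_add 1) (by simp)).const_mul ((1 : ℝ) / 2 ^ (j + 1))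
    simpa [distTerm] using h1
  · rw [Real.norm_of_nonneg (distTerm_nonneg _ _ _)]
    have h0 := normDist_nonneg (P.exponent j) (u i) g
    unfold distTerm
    rw [one_div_pow]
    refine mul_le_of_le_one_right (by positivity) ?_
    rw [div_le_one (by positivity)]
    linarith

theorem tendsto_normDist {ι : Type*} {l : Filter ι} {u : ι → BergmanInter Ω P}
    {g : BergmanInter Ω P} (h : Tendsto u l (𝓝 g)) (j : ℕ) :
    Tendsto (fun i => normDist (P.exponent j) (u i) g) l (𝓝 0) := by
  rw [Metric.tendsto_nhds]
  intro ε hε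
  obtain ⟨δ, hδ, H⟩ := exists_dist_lt_imp_normDist_lt Ω P j hε
  filter_upwards [Metric.tendsto_nhds.1 h δ hδ] with i hi
  rw [Real.dist_0_eq_abs, abs_of_nonneg (normDist_nonneg _ _ _)]
  exact H _ _ hi

/-- Local uniform bound for point evaluations by the distance. -/
theorem exists_norm_sub_le (hb : Bornology.IsBounded (Ω : Set ℂ)) (P : ExponentSeq q) {z₀ : ℂ}
    (hz₀ : z₀ ∈ Ω) : ∃ R > 0, ∃ C : ℝ, 0 ≤ C ∧ Metric.ball z₀ R ⊆ Ω ∧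
      ∀ f g : BergmanInter Ω P, ∀ z ∈ Metric.ball z₀ R,
        ‖f z - g z‖ ≤ C * normDist (P.exponent 0) f g := by
  obtain ⟨R, hR, C, hC, hsub, H⟩ := exists_enorm_le_mul_eLpNorm Ω.isOpen hb (P.one_lt 0).le hz₀
  refine ⟨R, hR, C.toReal, ENNReal.toReal_nonneg, hsub, fun f g z hz => ?_⟩
  have h1 := H _ (f.differentiableOn.sub g.differentiableOn) z hz
  have h2 := ENNReal.toReal_mono (ENNReal.mul_ne_top hC (eLpNorm_sub_ne_top f g 0)) h1
  rwa [ENNReal.toReal_mul, toReal_enorm] at h2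

theorem tendsto_apply (hb : Bornology.IsBounded (Ω : Set ℂ)) {ι : Type*} {l : Filter ι}
    {u : ι → BergmanInter Ω P} {g : BergmanInter Ω P} (h : Tendsto u l (𝓝 g)) (z : ℂ) :
    Tendsto (fun i => u i z) l (𝓝 (g z)) := by
  by_cases hz : z ∈ Ω
  · obtain ⟨R, hR, C, -, -, H⟩ := exists_norm_sub_le hb P hz
    rw [tendsto_iff_norm_sub_tendsto_zero]
    refine squeeze_zero (fun _ => norm_nonneg _)
      (fun i => H (u i) g z (Metric.mem_ball_self hR)) ?_
    simpa using (tendsto_normDist h 0).const_mul C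
  · simpa [eq_zero _ z hz] using tendsto_const_nhds

theorem exists_le_normDist_of_cauchySeq {u : ℕ → BergmanInter Ω P} (hu : CauchySeq u) (j : ℕ)
    {ε : ℝ} (hε : 0 < ε) : ∃ N, ∀ m ≥ N, ∀ n ≥ N, normDist (P.exponent j) (u m) (u n) < ε := by
  obtain ⟨δ, hδ, H⟩ := exists_dist_lt_imp_normDist_lt Ω P j hε
  obtain ⟨N, hN⟩ := Metric.cauchySeq_iff.1 hu δ hδ
  exact ⟨N, fun m hm n hn => H _ _ (hN m hm n hn)⟩

/-- A Cauchy sequence is Cauchy in every `L^{p_j}`. The first exponent already forces locally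
uniform convergence, hence a holomorphic limit; Fatou's lemma then gives convergence to this limit
in each `L^{p_j}`. -/
theorem completeSpace (hb : Bornology.IsBounded (Ω : Set ℂ)) :
    CompleteSpace (BergmanInter Ω P) := by
  refine Metric.complete_of_cauchySeq_tendsto fun u hu => ?_
  have hpt : ∀ z, ∃ y, Tendsto (fun n => u n z) atTop (𝓝 y) := by
    intro z
    by_cases hz : z ∈ Ω
    · obtain ⟨R, hR, C, hC, -, H⟩ := exists_norm_sub_le hb P hz
      refine cauchySeq_tendsto_of_complete (Metric.cauchySeq_iff.2 fun ε hε => ?_)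
      obtain ⟨N, hN⟩ := exists_le_normDist_of_cauchySeq hu 0 (ε := ε / (C + 1)) (by positivity)
      refine ⟨N, fun m hm n hn => ?_⟩
      rw [dist_eq_norm]
      have h1 := H (u m) (u n) z (Metric.mem_ball_self hR)
      have h2 := hN m hm n hn
      rw [lt_div_iff₀ (by positivity)] at h2
      nlinarith [normDist_nonneg (P.exponent 0) (u m) (u n)]
    · exact ⟨0, by simp [eq_zero _ z hz]⟩
  choose f hf using hpt
  have hloc : TendstoLocallyUniformlyOn (fun n => (u n : ℂ → ℂ)) f atTop Ω := by
    rw [Metric.tendstoLocallyUniformlyOn_iff]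
    intro ε hε z₀ hz₀
    obtain ⟨R, hR, C, hC, -, H⟩ := exists_norm_sub_le hb P hz₀
    refine ⟨Metric.ball z₀ R, mem_nhdsWithin_of_mem_nhds (Metric.ball_mem_nhds _ hR), ?_⟩
    obtain ⟨N, hN⟩ := exists_le_normDist_of_cauchySeq hu 0 (ε := ε / (2 * (C + 1)))
      (by positivity)
    filter_upwards [eventually_ge_atTop N] with m hm z hz
    have hle : ‖f z - u m z‖ ≤ ε / 2 := by
      refine le_of_tendsto ((hf z).sub_const (u m z)).norm ?_
      filter_upwards [eventually_ge_atTop N] with n hn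
      have h1 := H (u n) (u m) z hz
      have h2 := hN n hn m hm
      rw [lt_div_iff₀ (by positivity)] at h2
      nlinarith [normDist_nonneg (P.exponent 0) (u n) (u m)]
    rw [dist_eq_norm]
    linarith
  have hdiff : DifferentiableOn ℂ f Ω :=
    hloc.differentiableOn (Eventually.of_forall fun n => (u n).differentiableOn) Ω.isOpen
  have hmeas : AEStronglyMeasurable f (volume.restrict (Ω : Set ℂ)) :=
    hdiff.continuousOn.aestronglyMeasurable Ω.isOpen.measurableSet
  have hfatou : ∀ j, ∀ ε > 0, ∃ N, ∀ m ≥ N,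
      eLpNorm (fun z => u m z - f z) (P.exponent j) (volume.restrict (Ω : Set ℂ)) ≤
        ENNReal.ofReal ε := by
    intro j ε hε
    obtain ⟨N, hN⟩ := exists_le_normDist_of_cauchySeq hu j hε
    refine ⟨N, fun m hm => ?_⟩
    refine Lp.eLpNorm_le_of_ae_tendsto (u := atTop) (f := fun n z => u m z - u n z)
      (eventually_atTop.2 ⟨N, fun n hn => ?_⟩) (fun n => ((u m).memLp j).1.sub ((u n).memLp j).1)
      (Eventually.of_forall fun z => (hf z).const_sub (u m z))
    rw [← ofReal_normDist]
    exact ENNReal.ofReal_le_ofReal (hN m hm n hn).le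
  have hmem : ∀ j, MemLp f (P.exponent j) (volume.restrict (Ω : Set ℂ)) := by
    intro j
    obtain ⟨N, hN⟩ := hfatou j 1 one_pos
    have h1 : MemLp (fun z => u N z - f z) (P.exponent j) (volume.restrict (Ω : Set ℂ)) :=
      ⟨((u N).memLp j).1.sub hmeas, (hN N le_rfl).trans_lt ENNReal.ofReal_lt_top⟩
    have h2 := ((u N).memLp j).sub h1
    refine h2.ae_eq (Eventually.of_forall fun z => ?_)
    simp
  have : IsFiniteMeasure (volume.restrict (Ω : Set ℂ)) :=
    ⟨by rw [Measure.restrict_apply_univ]; exact hb.measure_lt_top⟩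
  let g : BergmanInter Ω P :=
    { toFun := f
      memBergman := fun p _ hp => by
        -- An arbitrary `p < q` lies below some `p_j`, and `Ω` has finite measure.
        obtain ⟨j, hj⟩ := (P.tendsto.eventually (lt_mem_nhds hp)).exists
        exact ⟨hdiff, (hmem j).mono_exponent hj.le⟩
      eq_zero := fun z hz => tendsto_nhds_unique (hf z) (by simp [eq_zero _ z hz]) }
  refine ⟨g, tendsto_of_normDist fun j => ?_⟩
  rw [Metric.tendsto_atTop]
  intro ε hε
  obtain ⟨N, hN⟩ := hfatou j (ε / 2) (by positivity)
  refine ⟨N, fun m hm => ?_⟩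
  rw [Real.dist_0_eq_abs, abs_of_nonneg (normDist_nonneg _ _ _)]
  have := ENNReal.toReal_mono ENNReal.ofReal_ne_top (hN m hm)
  rw [ENNReal.toReal_ofReal (by positivity)] at this
  change (eLpNorm (fun z => u m z - f z) _ _).toReal < ε
  linarith

/-! ### Genericity of a single non-integrability condition -/

/-- The element `f + c h` of the space. -/
def addSMul (f : BergmanInter Ω P) (c : ℂ) (h : BergmanInter Ω P) : BergmanInter Ω P where
  toFun z := f z + c * h z
  memBergman p h1 hp :=
    ⟨f.differentiableOn.add (h.differentiableOn.const_mul c),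
      (f.memBergman p h1 hp).2.add ((h.memBergman p h1 hp).2.const_mul c)⟩
  eq_zero z hz := by simp [eq_zero _ z hz]

theorem tendsto_addSMul (f h : BergmanInter Ω P) :
    Tendsto (fun c => addSMul f c h) (𝓝[≠] 0) (𝓝 f) := by
  refine tendsto_of_normDist fun j => ?_
  have : ∀ c, normDist (P.exponent j) (addSMul f c h) f =
      ‖c‖ * (eLpNorm h (P.exponent j) (volume.restrict (Ω : Set ℂ))).toReal := by
    intro c
    have h1 : (fun z => addSMul f c h z - f z) = c • h.toFun := by
      funext z
      simp [addSMul]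
    rw [normDist, h1, eLpNorm_const_smul, ENNReal.toReal_mul, toReal_enorm]
  simp_rw [this]
  have h2 : Tendsto (fun c : ℂ => ‖c‖) (𝓝[≠] 0) (𝓝 0) :=
    (tendsto_norm_zero).mono_left nhdsWithin_le_nhds
  simpa using h2.mul_const _

/-- Failing to be in `L^r(E)` is a generic property as soon as it holds for one function. -/
theorem dense_isGδ_not_memLp (hb : Bornology.IsBounded (Ω : Set ℂ)) {E : Set ℂ} (hE : E ⊆ Ω)
    (r : ℝ≥0∞) {h : BergmanInter Ω P}
    (hh : ¬ MemLp h r (volume.restrict E)) :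
    Dense {g : BergmanInter Ω P | ¬ MemLp g r (volume.restrict E)} ∧
      IsGδ {g : BergmanInter Ω P | ¬ MemLp g r (volume.restrict E)} := by
  have hmeas : ∀ g : BergmanInter Ω P, AEStronglyMeasurable g (volume.restrict E) := fun g =>
    (g.differentiableOn.continuousOn.aestronglyMeasurable Ω.isOpen.measurableSet).mono_measure
      (Measure.restrict_mono hE le_rfl)
  constructor
  · intro f
    by_cases hf : MemLp f r (volume.restrict E)
    · refine mem_closure_of_tendsto (tendsto_addSMul f h) ?_
      filter_upwards [self_mem_nhdsWithin] with c hc hcon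
      -- Otherwise `h = c⁻¹ ((f + c h) - f)` would be in `L^r(E)`.
      refine hh (((hcon.sub hf).const_mul c⁻¹).ae_eq (Eventually.of_forall fun z => ?_))
      have hc' : c ≠ 0 := hc
      simp [addSMul, hc']
    · exact subset_closure hf
  · have : {g : BergmanInter Ω P | ¬ MemLp g r (volume.restrict E)} =
        ⋂ n : ℕ, {g : BergmanInter Ω P | eLpNorm g r (volume.restrict E) ≤ n}ᶜ := by
      ext g
      simp only [Set.mem_ofPred_eq, Set.mem_iInter, Set.mem_compl_iff, MemLp, hmeas g, true_and,
        lt_top_iff_ne_top, not_not]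
      constructor
      · intro hg n
        simp [hg]
      · intro hg
        by_contra hne
        obtain ⟨n, hn⟩ := ENNReal.exists_nat_gt hne
        exact hg n hn.le
    rw [this]
    refine .iInter fun n => IsOpen.isGδ (isOpen_compl_iff.2 ?_)
    -- Convergence in the space is pointwise, so norm bounds on `E` pass to the limit by Fatou,
    -- whatever the relation between `r` and `q`.
    refine IsSeqClosed.isClosed fun u g hu hlim => ?_
    exact Lp.eLpNorm_le_of_ae_tendsto (u := atTop) (Eventually.of_forall hu) (fun k => hmeas (u k))
      (Eventually.of_forall fun z => tendsto_apply hb hlim z)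

/-- Countable intersections of generic properties. -/
theorem dense_isGδ_iInter (hb : Bornology.IsBounded (Ω : Set ℂ)) {ι : Type*} [Countable ι]
    {S : ι → Set (BergmanInter Ω P)} (h : ∀ i, Dense (S i) ∧ IsGδ (S i)) :
    Dense (⋂ i, S i) ∧ IsGδ (⋂ i, S i) := by
  have := completeSpace (P := P) hb
  exact ⟨dense_iInter_of_Gδ (fun i => (h i).2) fun i => (h i).1, .iInter fun i => (h i).2⟩

end BergmanInter

/-! ### Reduction to countably many conditions -/

theorem bddAbove_norm_image_iff_memLp_top {E : Set ℂ} (hE : IsOpen E) {f : ℂ → ℂ}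
    (hf : ContinuousOn f E) :
    BddAbove ((fun z => ‖f z‖) '' E) ↔ MemLp f ∞ (volume.restrict E) := by
  constructor
  · rintro ⟨C, hC⟩
    refine memLp_top_of_bound (hf.aestronglyMeasurable hE.measurableSet) C ?_
    refine (ae_restrict_iff' hE.measurableSet).2 (Eventually.of_forall fun z hz => ?_)
    exact hC ⟨z, hz, rfl⟩
  · intro h
    set C := (eLpNorm f ∞ (volume.restrict E)).toReal
    have hae : ∀ᵐ z ∂(volume.restrict E), ‖f z‖ ≤ C := by
      filter_upwards [ae_le_eLpNormEssSup (f := f) (μ := volume.restrict E)] with z hz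
      rw [← eLpNorm_exponent_top] at hz
      have := ENNReal.toReal_mono h.2.ne hz
      rwa [toReal_enorm] at this
    -- The almost everywhere bound becomes an equality of continuous functions, which then holds on
    -- all of the open set `E`.
    have heq : Set.EqOn (fun z => max ‖f z‖ C) (fun _ => C) E :=
      Measure.eqOn_open_of_ae_eq (hae.mono fun z hz => max_eq_right hz) hE
        (hf.norm.sup continuousOn_const) continuousOn_const
    refine ⟨C, ?_⟩
    rintro _ ⟨z, hz, rfl⟩
    exact max_eq_right_iff.1 (heq hz)

/-- A component of `V ∩ Ω` accumulates at some boundary point of `Ω` in `V`, if `V` is connected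
and not contained in `Ω`. -/
theorem exists_mem_frontier_mem_closure_connectedComponentIn {Ω V : Set ℂ} (hΩ : IsOpen Ω)
    (hV : IsOpen V) (hVc : IsPreconnected V) (hne : ¬ V ⊆ Ω) {c : ℂ} (hc : c ∈ V ∩ Ω) :
    ∃ w ∈ V, w ∈ frontier Ω ∧ w ∈ closure (connectedComponentIn (V ∩ Ω) c) := by
  set E := connectedComponentIn (V ∩ Ω) c with hE
  have hEo : IsOpen E := (hV.inter hΩ).connectedComponentIn
  have hEs : E ⊆ V ∩ Ω := connectedComponentIn_subset _ _
  have hcE : c ∈ E := mem_connectedComponentIn hc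
  -- Without such a point, `E` is relatively closed in `V`: a point of `V ∩ closure E` lies in `Ω`
  -- and can be adjoined to `E` without losing connectedness. As `E` is also open, `V = E ⊆ Ω`.
  by_contra! hcon
  have hcl : V ∩ closure E ⊆ E := by
    rintro x ⟨hxV, hxE⟩
    have hxΩ : x ∈ Ω := by
      by_contra hx
      refine hcon x hxV ?_ hxE
      rw [frontier, hΩ.interior_eq]
      exact Set.mem_sdiff_of_mem (closure_mono (hEs.trans Set.inter_subset_right) hxE) hx
    have hpre : IsPreconnected (insert x E) :=
      isPreconnected_connectedComponentIn.subset_closure (Set.subset_insert x E)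
        (Set.insert_subset hxE subset_closure)
    exact hpre.subset_connectedComponentIn (Set.mem_insert_of_mem x hcE)
      (Set.insert_subset (Set.mem_inter hxV hxΩ) hEs) (Set.mem_insert x E)
  have hsub : V ⊆ E := by
    refine hVc.subset_left_of_subset_union hEo isClosed_closure.isOpen_compl
      (disjoint_compl_right.mono_left subset_closure) (fun x hx => ?_) ⟨c, hc.1, hcE⟩
    by_cases hxE : x ∈ closure E
    · exact Or.inl (hcl ⟨hx, hxE⟩)
    · exact Or.inr hxE
  exact hne (hsub.trans (hEs.trans Set.inter_subset_right))

/-- The balls with centre in a countable dense set and radius `1 / (n + 1)`. -/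
def denseBall (i : ℕ × ℕ) : Set ℂ := Metric.ball (denseSeq ℂ i.1) (1 / ((i.2 : ℝ) + 1))

theorem isOpen_denseBall (i : ℕ × ℕ) : IsOpen (denseBall i) := Metric.isOpen_ball

theorem isPreconnected_denseBall (i : ℕ × ℕ) : IsPreconnected (denseBall i) :=
  (convex_ball _ _).isPreconnected

theorem exists_denseBall {w : ℂ} {U : Set ℂ} (hU : U ∈ 𝓝 w) :
    ∃ i, w ∈ denseBall i ∧ denseBall i ⊆ U := by
  obtain ⟨δ, hδ, hsub⟩ := Metric.mem_nhds_iff.1 hU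
  obtain ⟨n, hn⟩ := exists_nat_one_div_lt (half_pos hδ)
  obtain ⟨k, hk⟩ := (denseRange_denseSeq ℂ).exists_dist_lt w
    (show (0 : ℝ) < 1 / ((n : ℝ) + 1) by positivity)
  refine ⟨(k, n), hk, fun x hx => hsub ?_⟩
  have h1 : dist x (denseSeq ℂ k) < 1 / ((n : ℝ) + 1) := hx
  have := dist_triangle x (denseSeq ℂ k) w
  rw [dist_comm w] at hk
  rw [Metric.mem_ball]
  linarith

/-- Total unboundedness only has to be tested on countably many components. -/
theorem totallyUnbounded_iff_denseBall {Ω : Set ℂ} (hΩ : IsOpen Ω) (f : ℂ → ℂ) :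
    TotallyUnbounded Ω f ↔ ∀ i : {i : (ℕ × ℕ) × ℕ //
      ¬ denseBall i.1 ⊆ Ω ∧ denseSeq ℂ i.2 ∈ denseBall i.1 ∩ Ω},
      ¬ BddAbove ((fun z => ‖f z‖) ''
        connectedComponentIn (denseBall i.1.1 ∩ Ω) (denseSeq ℂ i.1.2)) := by
  constructor
  · rintro h ⟨⟨i, l⟩, hi, hl⟩ hbdd
    -- Near an accumulation point `w ∈ ∂Ω` of the given component, a small ball at `w` has a
    -- component contained in it.
    obtain ⟨w, hwV, hwf, hwE⟩ := exists_mem_frontier_mem_closure_connectedComponentIn hΩ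
      (isOpen_denseBall _) (isPreconnected_denseBall _) hi hl
    obtain ⟨δ, hδ, hsub⟩ := Metric.isOpen_iff.1 (isOpen_denseBall _) w hwV
    obtain ⟨c, hcE, hcw⟩ := Metric.mem_closure_iff.1 hwE δ hδ
    have hcE' := connectedComponentIn_subset _ _ hcE
    rw [dist_comm] at hcw
    refine h w hwf δ hδ c ⟨hcw, hcE'.2⟩ (hbdd.mono (Set.image_mono ?_))
    have := connectedComponentIn_mono c (Set.inter_subset_inter_left Ω hsub)
    rwa [← connectedComponentIn_eq hcE] at this
  · intro h w hw δ hδ c hc hbdd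
    have hwΩ : w ∉ Ω := fun hwΩ => by
      rw [frontier, hΩ.interior_eq] at hw
      exact hw.2 hwΩ
    -- The centre `w` need not be adherent to the component of `c`, so the small dense ball is taken
    -- around another boundary point `x` that is.
    obtain ⟨x, hxV, hxf, hxE⟩ := exists_mem_frontier_mem_closure_connectedComponentIn hΩ
      Metric.isOpen_ball (convex_ball w δ).isPreconnected
      (fun hs => hwΩ (hs (Metric.mem_ball_self hδ))) hc
    obtain ⟨i, hxi, hi⟩ := exists_denseBall (Metric.isOpen_ball.mem_nhds hxV)
    have hEo : IsOpen (connectedComponentIn (Metric.ball w δ ∩ Ω) c) :=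
      (Metric.isOpen_ball.inter hΩ).connectedComponentIn
    have hio := isOpen_denseBall i
    obtain ⟨l, hl⟩ := (denseRange_denseSeq ℂ).exists_mem_open (hio.inter hEo)
      (mem_closure_iff.1 hxE _ hio hxi)
    have hlE := connectedComponentIn_subset _ _ hl.2
    have hxΩ : x ∉ Ω := fun hxΩ => by
      rw [frontier, hΩ.interior_eq] at hxf
      exact hxf.2 hxΩ
    refine h ⟨(i, l), fun hs => hxΩ (hs hxi), hl.1, hlE.2⟩ (hbdd.mono (Set.image_mono ?_))
    have := connectedComponentIn_mono (denseSeq ℂ l) (Set.inter_subset_inter_left Ω hi)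
    rwa [← connectedComponentIn_eq hl.2] at this

theorem nowhereLocallyBergman_iff_denseBall {Ω : Set ℂ} {q : ℝ≥0∞} {f : ℂ → ℂ}
    (hf : DifferentiableOn ℂ f Ω) :
    NowhereLocallyBergman q Ω f ↔ ∀ i : {i : ℕ × ℕ // (denseBall i ∩ frontier Ω).Nonempty},
      ¬ MemLp f q (volume.restrict (denseBall i ∩ Ω)) := by
  constructor
  · rintro h ⟨i, w, hwi, hw⟩ hm
    obtain ⟨δ, hδ, hsub⟩ := Metric.isOpen_iff.1 (isOpen_denseBall _) w hwi
    exact h w hw δ hδ ⟨hf.mono Set.inter_subset_right,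
      hm.mono_measure (Measure.restrict_mono (Set.inter_subset_inter_left Ω hsub) le_rfl)⟩
  · intro h w hw δ hδ hm
    obtain ⟨i, hwi, hi⟩ := exists_denseBall (Metric.ball_mem_nhds w hδ)
    exact h ⟨i, w, hwi, hw⟩
      (hm.2.mono_measure (Measure.restrict_mono (Set.inter_subset_inter_left Ω hi) le_rfl))

namespace BergmanInter

variable {Ω : Opens ℂ} {q : ℝ≥0∞} {P : ExponentSeq q}

/-- If each boundary point is a pole-like singularity of some function of the space, then total
unboundedness is generic. -/
theorem dense_isGδ_totallyUnbounded (hb : Bornology.IsBounded (Ω : Set ℂ))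
    (H : ∀ w ∈ frontier (Ω : Set ℂ), ∃ h : BergmanInter Ω P,
      Tendsto (fun z => ‖h z‖) (𝓝[Ω] w) atTop) :
    Dense {g : BergmanInter Ω P | TotallyUnbounded Ω g} ∧
      IsGδ {g : BergmanInter Ω P | TotallyUnbounded Ω g} := by
  have hset : {g : BergmanInter Ω P | TotallyUnbounded Ω g} =
      ⋂ i : {i : (ℕ × ℕ) × ℕ //
        ¬ denseBall i.1 ⊆ (Ω : Set ℂ) ∧ denseSeq ℂ i.2 ∈ denseBall i.1 ∩ (Ω : Set ℂ)},
      {g : BergmanInter Ω P | ¬ MemLp g ∞ (volume.restrict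
        (connectedComponentIn (denseBall i.1.1 ∩ Ω) (denseSeq ℂ i.1.2)))} := by
    ext g
    simp only [Set.mem_ofPred_eq, Set.mem_iInter, totallyUnbounded_iff_denseBall Ω.isOpen]
    refine forall_congr' fun i => not_congr ?_
    refine bddAbove_norm_image_iff_memLp_top
      ((isOpen_denseBall _).inter Ω.isOpen).connectedComponentIn ?_
    exact g.differentiableOn.continuousOn.mono
      ((connectedComponentIn_subset _ _).trans Set.inter_subset_right)
  rw [hset]
  refine dense_isGδ_iInter hb fun i => ?_
  obtain ⟨w, -, hwf, hwE⟩ := exists_mem_frontier_mem_closure_connectedComponentIn Ω.isOpen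
    (isOpen_denseBall _) (isPreconnected_denseBall _) i.2.1 i.2.2
  obtain ⟨h, hh⟩ := H w hwf
  have hsub : connectedComponentIn (denseBall i.1.1 ∩ Ω) (denseSeq ℂ i.1.2) ⊆ Ω :=
    (connectedComponentIn_subset _ _).trans Set.inter_subset_right
  refine dense_isGδ_not_memLp hb hsub ∞ (h := h) fun hm => ?_
  rw [← bddAbove_norm_image_iff_memLp_top
    ((isOpen_denseBall _).inter Ω.isOpen).connectedComponentIn
    (h.differentiableOn.continuousOn.mono hsub)] at hm
  obtain ⟨C, hC⟩ := hm
  have hne : (𝓝[connectedComponentIn (denseBall i.1.1 ∩ Ω) (denseSeq ℂ i.1.2)] w).NeBot :=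
    mem_closure_iff_nhdsWithin_neBot.1 hwE
  have h1 := (hh.mono_left (nhdsWithin_mono w hsub)).eventually_gt_atTop C
  obtain ⟨z, hz, hzE⟩ := (h1.and self_mem_nhdsWithin).exists
  exact absurd (hC ⟨z, hzE, rfl⟩) (not_le.2 hz)

theorem dense_isGδ_nowhereLocallyBergman (hb : Bornology.IsBounded (Ω : Set ℂ))
    (H : ∀ w ∈ frontier (Ω : Set ℂ), ∃ h : BergmanInter Ω P,
      ∀ ε > 0, ¬ MemLp h q (volume.restrict (Metric.ball w ε ∩ Ω))) :
    Dense {g : BergmanInter Ω P | NowhereLocallyBergman q Ω g} ∧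
      IsGδ {g : BergmanInter Ω P | NowhereLocallyBergman q Ω g} := by
  have hset : {g : BergmanInter Ω P | NowhereLocallyBergman q Ω g} =
      ⋂ i : {i : ℕ × ℕ // (denseBall i ∩ frontier (Ω : Set ℂ)).Nonempty},
      {g : BergmanInter Ω P | ¬ MemLp g q (volume.restrict (denseBall i ∩ Ω))} := by
    ext g
    simp only [Set.mem_ofPred_eq, Set.mem_iInter,
      nowhereLocallyBergman_iff_denseBall g.differentiableOn]
  rw [hset]
  refine dense_isGδ_iInter hb fun i => ?_
  obtain ⟨w, hwi, hwf⟩ := i.2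
  obtain ⟨h, hh⟩ := H w hwf
  obtain ⟨δ, hδ, hsub⟩ := Metric.isOpen_iff.1 (isOpen_denseBall _) w hwi
  exact dense_isGδ_not_memLp hb Set.inter_subset_right q fun hm => hh δ hδ
    (hm.mono_measure (Measure.restrict_mono (Set.inter_subset_inter_left _ hsub) le_rfl))

end BergmanInter

/-! ### Holomorphic powers of `(z - ζ) / (z - w)` -/

/-- Away from `Ωᶜ`, the quotient `(z - y) / (z - x)` has a holomorphic logarithm if `x` and `y` lie
in a connected subset of `Ωᶜ`. -/
theorem exists_log_div_of_isPreconnected {K U : Set ℂ} (hK : IsPreconnected K) {ε : ℝ} (hε : 0 < ε)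
    (hU : ∀ z ∈ U, ∀ k ∈ K, ε < ‖z - k‖) {x y : ℂ} (hx : x ∈ K) (hy : y ∈ K) :
    ∃ L : ℂ → ℂ, DifferentiableOn ℂ L U ∧ ∀ z ∈ U, Complex.exp (L z) = (z - y) / (z - x) := by
  have hne : ∀ z ∈ U, ∀ k ∈ K, z - k ≠ 0 := fun z hz k hk =>
    norm_pos_iff.1 (hε.trans (hU z hz k hk))
  -- Existence of the logarithm is a symmetric and transitive relation in `x, y` that holds for
  -- nearby points, hence for any two points of a preconnected set. For nearby points the quotient
  -- is within distance 1 of 1, so the principal branch works.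
  refine hK.induction₂ (fun x y => ∃ L : ℂ → ℂ, DifferentiableOn ℂ L U ∧
    ∀ z ∈ U, Complex.exp (L z) = (z - y) / (z - x)) ?_ ?_ ?_ hx hy
  · intro a ha
    filter_upwards [mem_nhdsWithin_of_mem_nhds (Metric.ball_mem_nhds a hε)] with b hb
    have hslit : ∀ z ∈ U, (z - b) / (z - a) ∈ Complex.slitPlane := by
      intro z hz
      have h1 : (z - b) / (z - a) = 1 + (a - b) / (z - a) := by
        have := hne z hz a ha
        field_simp
        ring
      rw [h1]
      refine Complex.mem_slitPlane_of_norm_lt_one ?_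
      rw [norm_div, div_lt_one (norm_pos_iff.2 (hne z hz a ha))]
      rw [Metric.mem_ball, dist_comm, dist_eq_norm] at hb
      exact hb.trans (hU z hz a ha)
    refine ⟨fun z => Complex.log ((z - b) / (z - a)), ?_, fun z hz => ?_⟩
    · refine DifferentiableOn.clog ?_ hslit
      exact (differentiableOn_id.sub_const b).div (differentiableOn_id.sub_const a)
        fun z hz => hne z hz a ha
    · exact Complex.exp_log (Complex.slitPlane_ne_zero (hslit z hz))
  · rintro a b c ha hb hc ⟨L, hL, hLe⟩ ⟨M, hM, hMe⟩
    refine ⟨fun z => L z + M z, hL.add hM, fun z hz => ?_⟩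
    rw [Complex.exp_add, hLe z hz, hMe z hz]
    have := hne z hz a ha
    have := hne z hz b hb
    field_simp
  · rintro a b ha hb ⟨L, hL, hLe⟩
    refine ⟨fun z => -L z, hL.neg, fun z hz => ?_⟩
    rw [Complex.exp_neg, hLe z hz, inv_div]

/-- Two holomorphic logarithms of the same function on a ball differ by a constant. -/
theorem sub_eq_sub_of_exp_eq {a z : ℂ} {R : ℝ} {L M : ℂ → ℂ}
    (hL : DifferentiableOn ℂ L (Metric.ball a R)) (hM : DifferentiableOn ℂ M (Metric.ball a R))
    (h : ∀ z ∈ Metric.ball a R, Complex.exp (L z) = Complex.exp (M z))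
    (hz : z ∈ Metric.ball a R) : L z - M z = L a - M a := by
  have hR : 0 < R := dist_nonneg.trans_lt hz
  have hD : ∀ x ∈ Metric.ball a R, DifferentiableAt ℂ (fun z => L z - M z) x := fun x hx =>
    (hL.sub hM).differentiableAt (Metric.isOpen_ball.mem_nhds hx)
  have hone : ∀ x ∈ Metric.ball a R, Complex.exp (L x - M x) = 1 := fun x hx => by
    rw [Complex.exp_sub, h x hx, div_self (Complex.exp_ne_zero _)]
  refine Metric.isOpen_ball.is_const_of_deriv_eq_zero (convex_ball a R).isPreconnected
    (hL.sub hM) (fun x hx => ?_) hz (Metric.mem_ball_self hR)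
  have h1 := (hD x hx).hasDerivAt.cexp
  have h2 : (fun z => Complex.exp (L z - M z)) =ᶠ[𝓝 x] fun _ => 1 := by
    filter_upwards [Metric.isOpen_ball.mem_nhds hx] with y hy using hone y hy
  have h3 := h1.unique ((hasDerivAt_const x (1 : ℂ)).congr_of_eventuallyEq h2)
  rw [hone x hx, one_mul] at h3
  exact h3

/-- If `w` and `ζ` lie in the same component of `Ωᶜ`, then `|(z - ζ) / (z - w)| ^ α` is
the modulus of a holomorphic function on `Ω`. -/
theorem exists_differentiableOn_norm_eq_rpow {Ω : Set ℂ} (hΩ : IsOpen Ω) {w ζ : ℂ} (hw : w ∈ Ωᶜ)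
    (hζ : ζ ∈ connectedComponentIn Ωᶜ w) (α : ℝ) :
    ∃ h : ℂ → ℂ, DifferentiableOn ℂ h Ω ∧ ∀ z ∈ Ω, ‖h z‖ = (‖z - ζ‖ / ‖z - w‖) ^ α := by
  -- The logarithms exist only at a uniform distance from `Ωᶜ`, so `Ω` is exhausted by the sets `U
  -- n`.
  set U : ℕ → Set ℂ := fun n => {z | 1 / ((n : ℝ) + 1) < Metric.infDist z Ωᶜ} with hUdef
  have hUk : ∀ n, ∀ z ∈ U n, ∀ k ∈ connectedComponentIn Ωᶜ w, 1 / ((n : ℝ) + 1) < ‖z - k‖ := by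
    intro n z hz k hk
    rw [← dist_eq_norm]
    exact lt_of_lt_of_le hz (Metric.infDist_le_dist_of_mem (connectedComponentIn_subset _ _ hk))
  choose L hLd hLe using fun n : ℕ => exists_log_div_of_isPreconnected
    (isPreconnected_connectedComponentIn (x := w) (F := Ωᶜ))
    (show (0 : ℝ) < 1 / ((n : ℝ) + 1) by positivity) (hUk n) (mem_connectedComponentIn hw) hζ
  set H : ℕ → ℂ → ℂ := fun n z => Complex.exp (α * L n z) with hH
  have hHn : ∀ n, ∀ z ∈ U n, ‖H n z‖ = (‖z - ζ‖ / ‖z - w‖) ^ α := by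
    intro n z hz
    rw [← norm_div, ← hLe n z hz, hH, Complex.norm_exp, Complex.norm_exp, ← Real.exp_mul,
      Complex.re_ofReal_mul, mul_comm]
  have hloc : ∀ a ∈ Ω, ∃ R > 0, ∃ m, ∀ n ≥ m, Metric.ball a R ⊆ U n := by
    intro a ha
    have hd : 0 < Metric.infDist a Ωᶜ :=
      (hΩ.isClosed_compl.notMem_iff_infDist_pos ⟨w, hw⟩).1 (not_not.2 ha)
    obtain ⟨m, hm⟩ := exists_nat_one_div_lt (half_pos hd)
    refine ⟨Metric.infDist a Ωᶜ / 2, half_pos hd, m, fun n hn z hz => ?_⟩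
    have h1 := Metric.infDist_le_infDist_add_dist (s := Ωᶜ) (x := a) (y := z)
    rw [Metric.mem_ball, dist_comm] at hz
    have h2 : 1 / ((n : ℝ) + 1) ≤ 1 / ((m : ℝ) + 1) := by gcongr
    change 1 / ((n : ℝ) + 1) < Metric.infDist z Ωᶜ
    linarith
  -- The branches on different `U n` need not agree. Their moduli do, so an ultrafilter limit exists
  -- at each point by compactness of a closed disc.
  have hlim : ∀ z, ∃ y, z ∈ Ω → Tendsto (fun n => H n z) (hyperfilter ℕ) (𝓝 y) := by
    intro z
    by_cases hz : z ∈ Ω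
    · obtain ⟨R, hR, m, hm⟩ := hloc z hz
      obtain ⟨y, -, hy⟩ := (isCompact_closedBall (0 : ℂ) ((‖z - ζ‖ / ‖z - w‖) ^ α)).ultrafilter_le_nhds'
        ((hyperfilter ℕ).map fun n => H n z) (by
          rw [Ultrafilter.mem_map]
          refine Nat.hyperfilter_le_atTop (mem_atTop_sets.2 ⟨m, fun n hn => ?_⟩)
          rw [Set.mem_preimage, mem_closedBall_zero_iff]
          exact (hHn n z (hm n hn (Metric.mem_ball_self hR))).le)
      exact ⟨y, fun _ => hy⟩
    · exact ⟨0, fun h => absurd h hz⟩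
  choose h hh using hlim
  refine ⟨h, fun a ha => ?_, fun z hz => ?_⟩
  · obtain ⟨R, hR, m, hm⟩ := hloc a ha
    have hBΩ : Metric.ball a R ⊆ Ω := by
      intro z hz
      by_contra hzΩ
      have h1 : (1 : ℝ) / ((m : ℝ) + 1) < Metric.infDist z Ωᶜ := hm m le_rfl hz
      rw [Metric.infDist_zero_of_mem hzΩ] at h1
      exact absurd h1 (not_lt.2 (by positivity))
    -- On a small ball `L n - L m` is constant, so every `H n` with `n ≥ m` is a constant multiple
    -- of `H m`, and so is the limit. This gives holomorphy.
    have heq : ∀ z ∈ Metric.ball a R, h z = h a / H m a * H m z := by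
      intro z hz
      refine tendsto_nhds_unique (hh z (hBΩ hz)) ?_
      refine (((hh a ha).div_const (H m a)).mul_const (H m z)).congr' ?_
      filter_upwards [Nat.hyperfilter_le_atTop (eventually_ge_atTop m)] with n hn
      have h1 := sub_eq_sub_of_exp_eq ((hLd n).mono (hm n hn)) ((hLd m).mono (hm m le_rfl))
        (fun x hx => (hLe n x (hm n hn hx)).trans (hLe m x (hm m le_rfl hx)).symm) hz
      simp only [hH]
      rw [← Complex.exp_sub, ← Complex.exp_add]
      congr 1
      linear_combination (-(α : ℂ)) * h1
    have hd : DifferentiableOn ℂ (H m) (Metric.ball a R) :=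
      (((hLd m).mono (hm m le_rfl)).const_mul (α : ℂ)).cexp
    have hda : DifferentiableAt ℂ (fun z => h a / H m a * H m z) a :=
      (hd.const_mul _).differentiableAt (Metric.ball_mem_nhds a hR)
    refine (hda.congr_of_eventuallyEq ?_).differentiableWithinAt
    filter_upwards [Metric.ball_mem_nhds a hR] with z hz using heq z hz
  · obtain ⟨R, hR, m, hm⟩ := hloc z hz
    refine tendsto_nhds_unique (hh z hz).norm (tendsto_const_nhds.congr' ?_)
    filter_upwards [Nat.hyperfilter_le_atTop (eventually_ge_atTop m)] with n hn
    exact (hHn n z (hm n hn (Metric.mem_ball_self hR))).symm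

/-! ### Integrability of power and logarithmic singularities -/

theorem integrableOn_norm_sub_rpow {Ω : Set ℂ} (hb : Bornology.IsBounded Ω) (a : ℂ) {s : ℝ}
    (hs : s < 2) : IntegrableOn (fun z : ℂ => ‖z - a‖ ^ (-s)) Ω := by
  have hloc : LocallyIntegrable (fun z : ℂ => ‖z‖ ^ (-s)) volume := by
    refine locallyIntegrable_of_norm_le_rpow (C := 1) (α := s) (by simp) (by simpa using hs)
      (Eventually.of_forall fun z => ?_)
      (measurable_norm.pow_const (-s)).aestronglyMeasurable
    rw [one_mul, Real.norm_of_nonneg (by positivity)]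
  obtain ⟨R, hR⟩ := hb.subset_closedBall a
  have h1 : IntegrableOn (fun z : ℂ => ‖z‖ ^ (-s)) (Metric.closedBall 0 R) :=
    hloc.integrableOn_isCompact (isCompact_closedBall _ _)
  have h2 := ((measurePreserving_sub_right (volume : Measure ℂ) a).integrableOn_comp_preimage
    (MeasurableEquiv.subRight a).measurableEmbedding).2 h1
  refine h2.mono_set fun z hz => ?_
  have := hR hz
  rw [Metric.mem_closedBall, dist_eq_norm] at this
  simpa using this

/-- A function on a bounded open planar set with a singularity weaker than `|z - a| ^ (-2 / p)` is
in `L^p`. -/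
theorem memLp_of_norm_le_rpow {Ω : Set ℂ} (hΩ : IsOpen Ω) (hb : Bornology.IsBounded Ω) (a : ℂ)
    {p : ℝ≥0∞} (hp0 : p ≠ 0) (hpt : p ≠ ∞) {β C : ℝ} (hβ : β * p.toReal < 2)
    {E : Type*} [NormedAddCommGroup E] {f : ℂ → E}
    (hf : AEStronglyMeasurable f (volume.restrict Ω))
    (hle : ∀ z ∈ Ω, ‖f z‖ ≤ C * ‖z - a‖ ^ (-β)) : MemLp f p (volume.restrict Ω) := by
  have hm : AEStronglyMeasurable (fun z : ℂ => ‖z - a‖ ^ (-β)) (volume.restrict Ω) :=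
    ((measurable_id.sub_const a).norm.pow_const (-β)).aestronglyMeasurable
  have h1 : MemLp (fun z : ℂ => ‖z - a‖ ^ (-β)) p (volume.restrict Ω) := by
    rw [← integrable_norm_rpow_iff hm hp0 hpt]
    refine (integrableOn_norm_sub_rpow hb a hβ).congr (Eventually.of_forall fun z => ?_)
    simp only
    rw [Real.norm_of_nonneg (by positivity), ← Real.rpow_mul (norm_nonneg _), neg_mul]
  refine h1.of_le_mul hf (c := C) ?_
  refine (ae_restrict_iff' hΩ.measurableSet).2 (Eventually.of_forall fun z hz => ?_)
  rw [Real.norm_of_nonneg (by positivity)]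
  exact hle z hz

theorem memLp_log_norm_sub {Ω : Set ℂ} (hΩ : IsOpen Ω) (hb : Bornology.IsBounded Ω) {a : ℂ}
    (ha : a ∉ Ω) {p : ℝ≥0∞} (hp0 : p ≠ 0) (hpt : p ≠ ∞) :
    MemLp (fun z => Real.log ‖z - a‖) p (volume.restrict Ω) := by
  obtain ⟨R, hR⟩ := hb.subset_closedBall a
  have hppos : 0 < p.toReal := ENNReal.toReal_pos hp0 hpt
  set β := 1 / p.toReal
  have hβ : 0 < β := by positivity
  -- The constant comes from `log x ≤ x^β / β`, `-log x ≤ x^(-β) / β` and `x^β ≤ R^(2β) x^(-β)` for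
  -- `0 < x ≤ R`. Any positive `β < 2 / p` would serve.
  refine memLp_of_norm_le_rpow hΩ hb a hp0 hpt (β := β) (C := (R ^ (2 * β) + 1) / β) ?_
    (Real.measurable_log.comp (measurable_id.sub_const a).norm).aestronglyMeasurable fun z hz => ?_
  · simp only [β]
    rw [one_div_mul_cancel hppos.ne']
    norm_num
  · have hpos : 0 < ‖z - a‖ := norm_pos_iff.2 (sub_ne_zero.2 fun h => ha (h ▸ hz))
    have hzR : ‖z - a‖ ≤ R := by
      have := hR hz
      rwa [Metric.mem_closedBall, dist_eq_norm] at this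
    generalize ‖z - a‖ = x at *
    have h1 := Real.log_le_rpow_div hpos.le hβ
    have h2 := Real.log_le_rpow_div (inv_pos.2 hpos).le hβ
    rw [Real.log_inv, Real.inv_rpow hpos.le, ← Real.rpow_neg hpos.le] at h2
    have h3 : x ^ β ≤ R ^ (2 * β) * x ^ (-β) := by
      calc x ^ β = x ^ (2 * β) * x ^ (-β) := by rw [← Real.rpow_add hpos]; congr 1; ring
        _ ≤ _ := by gcongr
    have h4 : 0 < x ^ (-β) := Real.rpow_pos_of_pos hpos _
    have h5 : 0 < x ^ β := Real.rpow_pos_of_pos hpos _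
    rw [le_div_iff₀ hβ] at h1 h2
    rw [Real.norm_eq_abs, div_mul_eq_mul_div, le_div_iff₀ hβ]
    rcases abs_cases (Real.log x) with ⟨h, -⟩ | ⟨h, -⟩ <;> rw [h] <;> nlinarith

/-! ### Cones at `C^1` boundary points -/

theorem exists_interior_cone {f : ℂ → ℝ} {w : ℂ} (hf : DifferentiableAt ℝ f w)
    (h0 : f w = 0) (hd : fderiv ℝ f w ≠ 0) :
    ∃ v : ℂ, ∃ η > 0, v ≠ 0 ∧ ∀ᶠ t : ℝ in 𝓝[>] 0,
      (∀ z ∈ Metric.ball (w + t * v) (t * η), f z < 0) ∧ 0 < f (w - t * v) := by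
  obtain ⟨v, hv⟩ : ∃ v, fderiv ℝ f w v < 0 := by
    by_contra! h
    refine hd (ContinuousLinearMap.ext fun v => le_antisymm ?_ (h v))
    have := h (-v)
    rw [map_neg] at this
    simpa using this
  set D := fderiv ℝ f w with hD
  have hv0 : v ≠ 0 := by rintro rfl; simp at hv
  have hDpos : 0 < ‖D‖ := norm_pos_iff.2 hd
  set c := - D v with hc
  have hcpos : 0 < c := by simp only [hc]; linarith
  -- On the ball of radius `t η` the linear part is at most `-ct + ct/2`, and the Taylor remainder
  -- is made at most `ct/4`, so the sign is decided.
  set η := c / (2 * ‖D‖) with hη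
  have hηpos : 0 < η := by positivity
  have hN : 0 < ‖v‖ + η := by positivity
  have hlo := (hasFDerivAt_iff_isLittleO_nhds_zero.1 hf.hasFDerivAt).def
    (show 0 < c / (4 * (‖v‖ + η)) by positivity)
  obtain ⟨r, hr, hball⟩ := Metric.eventually_nhds_iff.1 hlo
  refine ⟨v, η, hηpos, hv0, ?_⟩
  have hsmall : ∀ᶠ t : ℝ in 𝓝[>] 0, t < r / (‖v‖ + η) :=
    mem_nhdsWithin_of_mem_nhds (gt_mem_nhds (by positivity))
  filter_upwards [hsmall, self_mem_nhdsWithin] with t ht ht0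
  have ht0 : 0 < t := ht0
  rw [lt_div_iff₀ hN] at ht
  have key : ∀ y : ℂ, ‖y‖ ≤ t * (‖v‖ + η) → |f (w + y) - D y| ≤ c * t / 4 := by
    intro y hy
    have h1 := hball (y := y) (by rw [dist_zero_right]; linarith)
    rw [h0, sub_zero, Real.norm_eq_abs] at h1
    refine h1.trans ?_
    calc c / (4 * (‖v‖ + η)) * ‖y‖ ≤ c / (4 * (‖v‖ + η)) * (t * (‖v‖ + η)) := by gcongr
      _ = c * t / 4 := by field_simp
  constructor
  · intro z hz
    rw [Metric.mem_ball, dist_eq_norm] at hz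
    set u := z - (w + t * v) with hu
    have hzw : z = w + (t * v + u) := by rw [hu]; ring
    have htv : ‖(t : ℂ) * v‖ = t * ‖v‖ := by
      rw [norm_mul, Complex.norm_real, Real.norm_of_nonneg ht0.le]
    have h1 := key (t * v + u) (by
      refine (norm_add_le _ _).trans ?_
      rw [htv]
      linarith)
    have h2 : D (t * v + u) = -(c * t) + D u := by
      rw [map_add, ← Complex.real_smul, map_smul, smul_eq_mul, hc]
      ring
    have h3 : |D u| ≤ c * t / 2 := by
      calc |D u| ≤ ‖D‖ * ‖u‖ := D.le_opNorm u
        _ ≤ ‖D‖ * (t * η) := by gcongr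
        _ = c * t / 2 := by rw [hη]; field_simp
    rw [← hzw, h2] at h1
    have := (abs_le.1 h1).2
    have := (abs_le.1 h3).2
    nlinarith [mul_pos hcpos ht0]
  · have h1 := key (-(t * v)) (by
      rw [norm_neg, norm_mul, Complex.norm_real, Real.norm_of_nonneg ht0.le]
      gcongr
      linarith)
    have h2 : D (-(t * v)) = c * t := by
      rw [map_neg, ← Complex.real_smul, map_smul, smul_eq_mul, hc]
      ring
    rw [h2, ← sub_eq_add_neg] at h1
    have := (abs_le.1 h1).1
    nlinarith [mul_pos hcpos ht0]

/-- `|z - w| ^ (-2)` is not integrable on an open set which contains a cone with vertex `w`. -/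
theorem lintegral_norm_sub_rpow_neg_two_eq_top {S : Set ℂ} {w v : ℂ} {η : ℝ} (hη : 0 < η)
    (hcone : ∀ᶠ t : ℝ in 𝓝[>] 0, Metric.ball (w + t * v) (t * η) ⊆ S) :
    ∫⁻ z in S, ENNReal.ofReal (‖z - w‖ ^ (-2 : ℝ)) = ∞ := by
  -- If the integral were finite, its parts over the balls `s t`, whose volumes tend to 0, would
  -- tend to 0. But `s t` has volume `π (t η)²` and `‖z - w‖ ≤ t N` on it, so by scaling each part
  -- is at least the constant `c`.
  by_contra hfin
  set s : ℝ → Set ℂ := fun t => Metric.ball (w + t * v) (t * η) with hs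
  have hvol : ∀ t, volume (s t) = ENNReal.ofReal (t * η) ^ 2 * NNReal.pi := fun t =>
    Complex.volume_ball _ _
  have hμ : Tendsto (fun t => (volume.restrict S) (s t)) (𝓝[>] 0) (𝓝 0) := by
    refine tendsto_of_tendsto_of_tendsto_of_le_of_le tendsto_const_nhds ?_ (fun _ => zero_le)
      (fun t => Measure.restrict_apply_le S (s t))
    have h1 : Tendsto (fun t : ℝ => ENNReal.ofReal (t * η) ^ 2 * NNReal.pi) (𝓝[>] 0)
        (𝓝 (ENNReal.ofReal (0 * η) ^ 2 * NNReal.pi)) := by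
      refine Tendsto.mono_left ?_ nhdsWithin_le_nhds
      refine ENNReal.Tendsto.mul_const (ENNReal.Tendsto.pow (ENNReal.tendsto_ofReal ?_))
        (Or.inr ENNReal.coe_ne_top)
      exact tendsto_id.mul_const η
    simpa [hvol] using h1
  have hlim := tendsto_setLIntegral_zero hfin hμ
  set N := ‖v‖ + η
  have hN : 0 < N := by positivity
  set c := ENNReal.ofReal (N ^ (-2 : ℝ) * η ^ 2) * NNReal.pi with hc
  have hcpos : 0 < c := by
    have : 0 < N ^ (-2 : ℝ) := Real.rpow_pos_of_pos hN _
    exact ENNReal.mul_pos (ENNReal.ofReal_pos.2 (by positivity)).ne' (by simp [NNReal.pi_ne_zero])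
  have hlow : ∀ᶠ t : ℝ in 𝓝[>] 0,
      c ≤ ∫⁻ z in s t, ENNReal.ofReal (‖z - w‖ ^ (-2 : ℝ)) ∂(volume.restrict S) := by
    filter_upwards [hcone, self_mem_nhdsWithin] with t hsub ht
    have ht : 0 < t := ht
    rw [Measure.restrict_restrict Metric.isOpen_ball.measurableSet,
      Set.inter_eq_left.2 hsub]
    calc c = ENNReal.ofReal ((t * N) ^ (-2 : ℝ)) * volume (s t) := by
          rw [hvol, hc, ← ENNReal.ofReal_pow (by positivity), ← mul_assoc,
            ← ENNReal.ofReal_mul (by positivity), Real.mul_rpow ht.le hN.le]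
          congr 2
          have : t ^ (-2 : ℝ) * t ^ 2 = 1 := by
            rw [← Real.rpow_natCast t 2, ← Real.rpow_add ht]
            norm_num
          linear_combination (-(N ^ (-2 : ℝ) * η ^ 2)) * this
      _ = ∫⁻ z in s t, ENNReal.ofReal ((t * N) ^ (-2 : ℝ)) := by rw [setLIntegral_const]
      _ ≤ _ := by
          -- The point `w` is excluded because `0 ^ (-2)` is 0 by convention, which breaks
          -- monotonicity.
          have hne : ∀ᵐ z ∂(volume : Measure ℂ), z ≠ w := by simp [ae_iff]
          refine lintegral_mono_ae ((ae_restrict_iff' Metric.isOpen_ball.measurableSet).2 ?_)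
          filter_upwards [hne] with z hzw hz
          refine ENNReal.ofReal_le_ofReal (Real.rpow_le_rpow_of_nonpos
            (norm_pos_iff.2 (sub_ne_zero.2 hzw)) ?_ (by norm_num))
          rw [Metric.mem_ball, dist_eq_norm] at hz
          calc ‖z - w‖ = ‖(z - (w + t * v)) + t * v‖ := by congr 1; ring
            _ ≤ ‖z - (w + t * v)‖ + ‖(t : ℂ) * v‖ := norm_add_le _ _
            _ ≤ t * η + t * ‖v‖ := by
              rw [norm_mul, Complex.norm_real, Real.norm_of_nonneg ht.le]
              linarith
            _ = t * N := by ring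
  exact absurd (ge_of_tendsto hlim hlow) (not_le.2 hcpos)

theorem notMem_of_mem_frontier {Ω : Opens ℂ} {w : ℂ} (hw : w ∈ frontier (Ω : Set ℂ)) : w ∉ Ω := by
  rw [frontier, Ω.isOpen.interior_eq] at hw
  exact hw.2

/-- An open set with `C^1` boundary contains an interior cone at each boundary point, and its
complement contains a segment. -/
theorem HasC1Boundary.exists_cone {Ω : Opens ℂ} (h : HasC1Boundary Ω) {w : ℂ}
    (hw : w ∈ frontier (Ω : Set ℂ)) :
    ∃ v : ℂ, ∃ η > 0, v ≠ 0 ∧ ∀ᶠ t : ℝ in 𝓝[>] 0,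
      Metric.ball (w + t * v) (t * η) ⊆ (Ω : Set ℂ) ∧ w - t * v ∉ Ω := by
  obtain ⟨U, ρ, hU, hwU, hρ, hdρ, hΩU⟩ := h w hw
  have hmem : ∀ z ∈ U, (z ∈ Ω ↔ ρ z < 0) := fun z hz => by
    have := Set.ext_iff.1 hΩU z
    simpa [hz] using this
  have hdiff : DifferentiableAt ℝ ρ w :=
    (hρ.differentiableOn one_ne_zero).differentiableAt (hU.mem_nhds hwU)
  have h0 : ρ w = 0 := by
    refine le_antisymm ?_ (not_lt.1 fun hlt => notMem_of_mem_frontier hw ((hmem w hwU).2 hlt))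
    by_contra! hpos
    obtain ⟨z, ⟨hz, hzU⟩, hzΩ⟩ := mem_closure_iff_nhds.1 (frontier_subset_closure hw) _
      (Filter.inter_mem (hdiff.continuousAt.eventually (lt_mem_nhds hpos)) (hU.mem_nhds hwU))
    exact lt_asymm hz ((hmem z hzU).1 hzΩ)
  obtain ⟨v, η, hη, hv, hev⟩ := exists_interior_cone hdiff h0 (hdρ w hwU)
  refine ⟨v, η, hη, hv, ?_⟩
  obtain ⟨r, hr, hrU⟩ := Metric.isOpen_iff.1 hU w hwU
  have hN : 0 < ‖v‖ + η := by positivity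
  have hsmall : ∀ᶠ t : ℝ in 𝓝[>] 0, t < r / (‖v‖ + η) :=
    mem_nhdsWithin_of_mem_nhds (gt_mem_nhds (by positivity))
  filter_upwards [hev, hsmall, self_mem_nhdsWithin] with t ht htr ht0
  have ht0 : 0 < t := ht0
  rw [lt_div_iff₀ hN] at htr
  have htv : ‖(t : ℂ) * v‖ = t * ‖v‖ := by
    rw [norm_mul, Complex.norm_real, Real.norm_of_nonneg ht0.le]
  refine ⟨fun z hz => (hmem z (hrU ?_)).2 (ht.1 z hz), fun hΩ => ?_⟩
  · rw [Metric.mem_ball, dist_eq_norm] at hz ⊢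
    calc ‖z - w‖ = ‖(z - (w + t * v)) + t * v‖ := by congr 1; ring
      _ ≤ ‖z - (w + t * v)‖ + ‖(t : ℂ) * v‖ := norm_add_le _ _
      _ < r := by rw [htv]; linarith
  · refine lt_asymm ht.2 ((hmem _ (hrU ?_)).1 hΩ)
    rw [Metric.mem_ball, dist_eq_norm, sub_sub_cancel_left, norm_neg, htv]
    nlinarith

/-- The segment leaves `w` in the direction opposite to the interior cone. It supplies a branch cut
for the logarithm and a second point in the component of `Ωᶜ`. -/
theorem HasC1Boundary.exists_segment_subset_compl {Ω : Opens ℂ} (h : HasC1Boundary Ω) {w : ℂ}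
    (hw : w ∈ frontier (Ω : Set ℂ)) : ∃ ζ ≠ w, segment ℝ w ζ ⊆ (Ω : Set ℂ)ᶜ := by
  obtain ⟨v, η, -, hv, hev⟩ := h.exists_cone hw
  obtain ⟨t₀, ht₀, hsub⟩ := mem_nhdsGT_iff_exists_Ioc_subset.1 hev
  have ht₀ : 0 < t₀ := ht₀
  refine ⟨w - t₀ * v, ?_, ?_⟩
  · simpa [sub_eq_self] using ⟨ht₀.ne', hv⟩
  · rw [segment_eq_image']
    rintro _ ⟨s, ⟨hs0, hs1⟩, rfl⟩
    rcases hs0.eq_or_lt with rfl | hs0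
    · simpa using notMem_of_mem_frontier hw
    · have := (hsub (show s * t₀ ∈ Set.Ioc 0 t₀ from ⟨by positivity, by nlinarith⟩)).2
      rw [Set.mem_compl_iff]
      convert this using 1
      simp only [Complex.real_smul]
      push_cast
      rw [SetLike.mem_coe]
      ring_nf

theorem HasC1Boundary.connectedComponentIn_diff_nonempty {Ω : Opens ℂ} (h : HasC1Boundary Ω)
    {w : ℂ} (hw : w ∈ frontier (Ω : Set ℂ)) :
    (connectedComponentIn (Ω : Set ℂ)ᶜ w \ {w}).Nonempty := by
  obtain ⟨ζ, hζ, hseg⟩ := h.exists_segment_subset_compl hw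
  exact ⟨ζ, (convex_segment w ζ).isPreconnected.subset_connectedComponentIn
    (left_mem_segment ℝ w ζ) hseg (right_mem_segment ℝ w ζ), hζ⟩

/-! ### Singular functions at a boundary point -/

theorem tendsto_norm_inv_sub_atTop (w : ℂ) :
    Tendsto (fun z => ‖z - w‖⁻¹) (𝓝[≠] w) atTop :=
  (tendsto_norm_sub_self_nhdsNE w).inv_tendsto_nhdsGT_zero

theorem tendsto_norm_div_norm_sub_atTop {w ζ : ℂ} (h : ζ ≠ w) :
    Tendsto (fun z => ‖z - ζ‖ / ‖z - w‖) (𝓝[≠] w) atTop := by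
  simp_rw [div_eq_mul_inv]
  have hc : Tendsto (fun z => ‖z - ζ‖) (𝓝[≠] w) (𝓝 ‖w - ζ‖) :=
    ((continuous_id.sub continuous_const).norm.tendsto w).mono_left nhdsWithin_le_nhds
  exact hc.pos_mul_atTop (norm_pos_iff.2 (sub_ne_zero.2 h.symm)) (tendsto_norm_inv_sub_atTop w)

theorem nhdsWithin_le_nhdsNE {Ω : Opens ℂ} {w : ℂ} (hw : w ∉ Ω) : 𝓝[Ω] w ≤ 𝓝[≠] w :=
  nhdsWithin_mono w fun _ hz h => hw (h ▸ hz)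

namespace BergmanInter

variable {Ω : Opens ℂ} {q : ℝ≥0∞} {P : ExponentSeq q}

/-- The element of the space given by the restriction of a function to `Ω`. -/
def ofMemLp (P : ExponentSeq q) (f : ℂ → ℂ) (hd : DifferentiableOn ℂ f Ω)
    (hm : ∀ p : ℝ≥0∞, 1 ≤ p → p < q → MemLp f p (volume.restrict (Ω : Set ℂ))) :
    BergmanInter Ω P where
  toFun := (Ω : Set ℂ).indicator f
  memBergman p h1 hp :=
    ⟨hd.congr fun _ hz => Set.indicator_of_mem hz f,
      (hm p h1 hp).ae_eq (indicator_ae_eq_restrict Ω.isOpen.measurableSet).symm⟩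
  eq_zero _ hz := Set.indicator_of_notMem hz f

theorem ofMemLp_apply {f : ℂ → ℂ} (hd : DifferentiableOn ℂ f Ω)
    (hm : ∀ p : ℝ≥0∞, 1 ≤ p → p < q → MemLp f p (volume.restrict (Ω : Set ℂ))) {z : ℂ}
    (hz : z ∈ Ω) : ofMemLp P f hd hm z = f z :=
  Set.indicator_of_mem hz f

theorem exists_tendsto_norm_atTop_of_two (hb : Bornology.IsBounded (Ω : Set ℂ))
    (P : ExponentSeq 2) {w : ℂ} (hw : w ∉ Ω) :
    ∃ h : BergmanInter Ω P, Tendsto (fun z => ‖h z‖) (𝓝[Ω] w) atTop := by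
  have hd : DifferentiableOn ℂ (fun z => (z - w)⁻¹) Ω :=
    (differentiableOn_id.sub_const w).inv fun z hz => sub_ne_zero.2 fun h => hw (h ▸ hz)
  refine ⟨ofMemLp P _ hd fun p h1 hp => ?_, ?_⟩
  · have hpt : p ≠ ∞ := (hp.trans (by simp)).ne
    refine memLp_of_norm_le_rpow Ω.isOpen hb w (one_pos.trans_le h1).ne' hpt
      (β := 1) (C := 1) ?_ (hd.continuousOn.aestronglyMeasurable Ω.isOpen.measurableSet)
      fun z _ => ?_
    · rw [one_mul]
      simpa using (ENNReal.toReal_lt_toReal hpt (by simp)).2 hp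
    · rw [one_mul, Real.rpow_neg_one, norm_inv]
  · refine ((tendsto_norm_inv_sub_atTop w).mono_left (nhdsWithin_le_nhdsNE hw)).congr' ?_
    filter_upwards [self_mem_nhdsWithin] with z hz
    rw [ofMemLp_apply hd _ hz, norm_inv]

/-- The exponent `2 / q` is critical: `(2 / q) p < 2` exactly when `p < q`. -/
theorem exists_norm_eq_rpow (hb : Bornology.IsBounded (Ω : Set ℂ)) (P : ExponentSeq q)
    (hq : 1 < q) (hqt : q ≠ ∞) {w ζ : ℂ} (hw : w ∉ Ω)
    (hζ : ζ ∈ connectedComponentIn (Ω : Set ℂ)ᶜ w) :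
    ∃ h : BergmanInter Ω P, ∀ z ∈ Ω, ‖h z‖ = (‖z - ζ‖ / ‖z - w‖) ^ (2 / q.toReal) := by
  have hq0 : 0 < q.toReal := ENNReal.toReal_pos (one_pos.trans hq).ne' hqt
  obtain ⟨f, hd, hf⟩ := exists_differentiableOn_norm_eq_rpow Ω.isOpen hw hζ (2 / q.toReal)
  obtain ⟨R, hR⟩ := hb.subset_closedBall ζ
  refine ⟨ofMemLp P f hd fun p h1 hp => ?_, fun z hz => by rw [ofMemLp_apply hd _ hz, hf z hz]⟩
  have hpt : p ≠ ∞ := hp.ne_top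
  refine memLp_of_norm_le_rpow Ω.isOpen hb w (one_pos.trans_le h1).ne' hpt
    (β := 2 / q.toReal) (C := R ^ (2 / q.toReal)) ?_
    (hd.continuousOn.aestronglyMeasurable Ω.isOpen.measurableSet) fun z hz => ?_
  · have := (ENNReal.toReal_lt_toReal hpt hqt).2 hp
    rw [div_mul_eq_mul_div, div_lt_iff₀ hq0]
    linarith
  · have := hR hz
    rw [Metric.mem_closedBall, dist_eq_norm] at this
    rw [hf z hz, Real.div_rpow (norm_nonneg _) (norm_nonneg _), div_eq_mul_inv,
      ← Real.rpow_neg (norm_nonneg _)]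
    gcongr

theorem tendsto_norm_atTop_of_norm_eq_rpow {h : BergmanInter Ω P} {w ζ : ℂ} (hw : w ∉ Ω)
    (hζ : ζ ≠ w) {α : ℝ} (hα : 0 < α) (hh : ∀ z ∈ Ω, ‖h z‖ = (‖z - ζ‖ / ‖z - w‖) ^ α) :
    Tendsto (fun z => ‖h z‖) (𝓝[Ω] w) atTop := by
  refine (((tendsto_rpow_atTop hα).comp (tendsto_norm_div_norm_sub_atTop hζ)).mono_left
    (nhdsWithin_le_nhdsNE hw)).congr' ?_
  filter_upwards [self_mem_nhdsWithin] with z hz using (hh z hz).symm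

/-- Near `w` the factor `‖z - ζ‖` is bounded below, so `‖h‖^q` dominates a multiple of `‖z -
w‖^(-2)`, which is not integrable over a cone at `w`. -/
theorem not_memLp_of_norm_eq_rpow {h : BergmanInter Ω P} (hq : 1 < q) (hqt : q ≠ ∞)
    {w ζ v : ℂ} {η : ℝ} (hη : 0 < η)
    (hcone : ∀ᶠ t : ℝ in 𝓝[>] 0, Metric.ball (w + t * v) (t * η) ⊆ (Ω : Set ℂ)) (hζ : ζ ≠ w)
    (hh : ∀ z ∈ Ω, ‖h z‖ = (‖z - ζ‖ / ‖z - w‖) ^ (2 / q.toReal)) {ε : ℝ} (hε : 0 < ε) :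
    ¬ MemLp h q (volume.restrict (Metric.ball w ε ∩ Ω)) := by
  intro hm
  have hq0 : 0 < q.toReal := ENNReal.toReal_pos (one_pos.trans hq).ne' hqt
  set d := ‖w - ζ‖ / 2 with hd
  have hdpos : 0 < d := half_pos (norm_pos_iff.2 (sub_ne_zero.2 hζ.symm))
  set S := Metric.ball w (min ε d) ∩ (Ω : Set ℂ) with hS
  have hSm : MeasurableSet S := (Metric.isOpen_ball.inter Ω.isOpen).measurableSet
  have hmS : MemLp h q (volume.restrict S) := hm.mono_measure (Measure.restrict_mono
    (Set.inter_subset_inter_left _ (Metric.ball_subset_ball (min_le_left _ _))) le_rfl)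
  have hint := (integrable_norm_rpow_iff hmS.1 (one_pos.trans hq).ne' hqt).2 hmS
  have hint2 : Integrable (fun z : ℂ => ‖z - w‖ ^ (-2 : ℝ)) (volume.restrict S) := by
    refine (hint.const_mul (d ^ (-2 : ℝ))).mono'
      ((measurable_id.sub_const w).norm.pow_const _).aestronglyMeasurable ?_
    refine (ae_restrict_iff' hSm).2 (Eventually.of_forall fun z hz => ?_)
    have hzd : d ≤ ‖z - ζ‖ := by
      have h1 : ‖z - w‖ < d := by
        rw [← dist_eq_norm]
        exact (Metric.mem_ball.1 hz.1).trans_le (min_le_right _ _)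
      have h2 : ‖w - ζ‖ ≤ ‖z - ζ‖ + ‖z - w‖ := by
        rw [← norm_neg (z - w)]
        calc ‖w - ζ‖ = ‖(z - ζ) + -(z - w)‖ := by congr 1; ring
          _ ≤ _ := norm_add_le _ _
      linarith
    rw [Real.norm_of_nonneg (by positivity), hh z hz.2, ← Real.rpow_mul (by positivity),
      div_mul_cancel₀ _ hq0.ne', Real.div_rpow (norm_nonneg _) (norm_nonneg _),
      Real.rpow_neg hdpos.le, Real.rpow_neg (norm_nonneg _), div_eq_mul_inv, ← mul_assoc]
    refine le_mul_of_one_le_left (by positivity) ?_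
    rw [inv_mul_eq_div, one_le_div (by positivity)]
    gcongr
  have htop := lintegral_norm_sub_rpow_neg_two_eq_top (S := S) (w := w) (v := v) hη (by
    have hN : 0 < ‖v‖ + η := by positivity
    have hsmall : ∀ᶠ t : ℝ in 𝓝[>] 0, t < min ε d / (‖v‖ + η) :=
      mem_nhdsWithin_of_mem_nhds (gt_mem_nhds (by positivity))
    filter_upwards [hcone, hsmall, self_mem_nhdsWithin] with t ht htr ht0
    have ht0 : 0 < t := ht0
    rw [lt_div_iff₀ hN] at htr
    refine Set.subset_inter (Metric.ball_subset_ball' ?_) ht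
    rw [dist_eq_norm, add_sub_cancel_left, norm_mul, Complex.norm_real,
      Real.norm_of_nonneg ht0.le]
    linarith)
  have hfin := hint2.2
  rw [hasFiniteIntegral_iff_ofReal (Eventually.of_forall fun z => by positivity)] at hfin
  exact hfin.ne htop

theorem not_memLp_top_of_tendsto {h : BergmanInter Ω P} {w : ℂ} (hw : w ∈ frontier (Ω : Set ℂ))
    (hh : Tendsto (fun z => ‖h z‖) (𝓝[Ω] w) atTop) {ε : ℝ} (hε : 0 < ε) :
    ¬ MemLp h ∞ (volume.restrict (Metric.ball w ε ∩ Ω)) := by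
  rw [← bddAbove_norm_image_iff_memLp_top (Metric.isOpen_ball.inter Ω.isOpen)
    (h.differentiableOn.continuousOn.mono Set.inter_subset_right)]
  rintro ⟨C, hC⟩
  have hne : (𝓝[Ω] w).NeBot := mem_closure_iff_nhdsWithin_neBot.1 (frontier_subset_closure hw)
  have hev : ∀ᶠ z in 𝓝[Ω] w, z ∈ (Ω : Set ℂ) := self_mem_nhdsWithin
  have hball : ∀ᶠ z in 𝓝[Ω] w, z ∈ Metric.ball w ε :=
    mem_nhdsWithin_of_mem_nhds (Metric.ball_mem_nhds w hε)
  obtain ⟨z, hz, hzΩ, hzb⟩ := ((hh.eventually_gt_atTop C).and (hev.and hball)).exists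
  exact absurd (hC ⟨z, ⟨hzb, hzΩ⟩, rfl⟩) (not_le.2 hz)

/-- The principal logarithm of `(z - w) / (z - ζ)` for a segment `[w, ζ]` outside `Ω`. -/
theorem exists_tendsto_norm_atTop_of_segment (hb : Bornology.IsBounded (Ω : Set ℂ))
    (P : ExponentSeq ∞) {w ζ : ℂ} (hζ : ζ ≠ w) (hseg : segment ℝ w ζ ⊆ (Ω : Set ℂ)ᶜ) :
    ∃ h : BergmanInter Ω P, Tendsto (fun z => ‖h z‖) (𝓝[Ω] w) atTop := by
  have hw : w ∉ Ω := hseg (left_mem_segment ℝ w ζ)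
  have hζΩ : ζ ∉ Ω := hseg (right_mem_segment ℝ w ζ)
  have hneζ : ∀ z ∈ Ω, z - ζ ≠ 0 := fun z hz => sub_ne_zero.2 fun h => hζΩ (h ▸ hz)
  have hnew : ∀ z ∈ Ω, z - w ≠ 0 := fun z hz => sub_ne_zero.2 fun h => hw (h ▸ hz)
  have hslit : ∀ z ∈ Ω, (z - w) / (z - ζ) ∈ Complex.slitPlane := by
    intro z hz
    by_contra hns
    rw [Complex.mem_slitPlane_iff_not_le_zero, not_not, Complex.nonpos_iff] at hns
    obtain ⟨hre, him⟩ := hns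
    set s := -((z - w) / (z - ζ)).re with hs
    have hs0 : 0 ≤ s := by simp only [hs]; linarith
    have h1 : (z - w) / (z - ζ) = ((-s : ℝ) : ℂ) := by
      apply Complex.ext <;> simp [hs, him]
    rw [div_eq_iff (hneζ z hz)] at h1
    push_cast at h1
    have hs1 : (1 + (s : ℂ)) ≠ 0 := by
      norm_cast
      positivity
    -- Solving `(z - w) / (z - ζ) = -s` with `s ≥ 0` gives `z = (w + s ζ) / (1 + s)`, a point of the
    -- segment.
    refine hseg ⟨1 / (1 + s), s / (1 + s), by positivity, by positivity, by field_simp, ?_⟩ hz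
    simp only [Complex.real_smul]
    push_cast
    field_simp
    linear_combination -h1
  set f : ℂ → ℂ := fun z => Complex.log ((z - w) / (z - ζ)) with hf
  have hd : DifferentiableOn ℂ f Ω := DifferentiableOn.clog
    ((differentiableOn_id.sub_const w).div (differentiableOn_id.sub_const ζ) hneζ) hslit
  have hre : ∀ z ∈ Ω, (f z).re = Real.log ‖z - w‖ - Real.log ‖z - ζ‖ := fun z hz => by
    rw [hf, Complex.log_re, norm_div, Real.log_div (norm_ne_zero_iff.2 (hnew z hz))
      (norm_ne_zero_iff.2 (hneζ z hz))]
  have hfin : IsFiniteMeasure (volume.restrict (Ω : Set ℂ)) :=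
    ⟨by rw [Measure.restrict_apply_univ]; exact hb.measure_lt_top⟩
  refine ⟨ofMemLp P f hd fun p h1 hp => ?_, ?_⟩
  · have hp0 : p ≠ 0 := (one_pos.trans_le h1).ne'
    -- The real part is a difference of two logarithms lying in every `L^p` with `p < ∞`; the
    -- imaginary part is an argument, bounded by `π`.
    have hlog := ((memLp_log_norm_sub Ω.isOpen hb hw hp0 hp.ne).sub
      (memLp_log_norm_sub Ω.isOpen hb hζΩ hp0 hp.ne)).norm.add
      (memLp_const (μ := volume.restrict (Ω : Set ℂ)) (p := p) Real.pi)
    refine hlog.mono (hd.continuousOn.aestronglyMeasurable Ω.isOpen.measurableSet)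
      ((ae_restrict_iff' Ω.isOpen.measurableSet).2 (Eventually.of_forall fun z hz => ?_))
    refine le_trans ?_ (Real.le_norm_self _)
    refine (Complex.norm_le_abs_re_add_abs_im _).trans ?_
    rw [hre z hz]
    refine add_le_add le_rfl ?_
    rw [hf, Complex.log_im]
    exact Complex.abs_arg_le_pi _
  · have h1 := ((Real.tendsto_log_atTop.comp (tendsto_norm_div_norm_sub_atTop hζ)).mono_left
      (nhdsWithin_le_nhdsNE hw))
    refine tendsto_atTop_mono' _ ?_ h1
    filter_upwards [self_mem_nhdsWithin] with z hz
    rw [ofMemLp_apply hd _ hz]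
    refine le_trans ?_ ((neg_le_abs _).trans (Complex.abs_re_le_norm _))
    rw [hre z hz, Function.comp_apply, Real.log_div (norm_ne_zero_iff.2 (hneζ z hz))
      (norm_ne_zero_iff.2 (hnew z hz))]
    linarith

/-! ### Conclusions -/

theorem dense_isGδ_totallyUnbounded_of_connectedComponentIn
    (hb : Bornology.IsBounded (Ω : Set ℂ))
    (hΩ : ∀ ζ ∈ frontier (Ω : Set ℂ), (connectedComponentIn (Ω : Set ℂ)ᶜ ζ \ {ζ}).Nonempty)
    (hq : 1 < q) (hqt : q ≠ ∞) :
    Dense {g : BergmanInter Ω P | TotallyUnbounded Ω g} ∧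
      IsGδ {g : BergmanInter Ω P | TotallyUnbounded Ω g} := by
  refine dense_isGδ_totallyUnbounded hb fun w hw => ?_
  obtain ⟨ζ, hζ, hne⟩ := hΩ w hw
  have hwΩ := notMem_of_mem_frontier hw
  obtain ⟨h, hh⟩ := exists_norm_eq_rpow hb P hq hqt hwΩ hζ
  exact ⟨h, tendsto_norm_atTop_of_norm_eq_rpow hwΩ hne
    (div_pos two_pos (ENNReal.toReal_pos (one_pos.trans hq).ne' hqt)) hh⟩

/-- Both properties are generic separately, and Baire's theorem intersects them. The case `q = ∞`
stands apart because the critical power degenerates and the logarithm replaces it. -/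
theorem dense_isGδ_of_hasC1Boundary (hb : Bornology.IsBounded (Ω : Set ℂ))
    (hΩ : HasC1Boundary Ω) (hq : 1 < q) :
    Dense {g : BergmanInter Ω P | TotallyUnbounded Ω g ∧ NowhereLocallyBergman q Ω g} ∧
      IsGδ {g : BergmanInter Ω P | TotallyUnbounded Ω g ∧ NowhereLocallyBergman q Ω g} := by
  have := completeSpace (P := P) hb
  suffices h : (Dense {g : BergmanInter Ω P | TotallyUnbounded Ω g} ∧
      IsGδ {g : BergmanInter Ω P | TotallyUnbounded Ω g}) ∧
      (Dense {g : BergmanInter Ω P | NowhereLocallyBergman q Ω g} ∧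
      IsGδ {g : BergmanInter Ω P | NowhereLocallyBergman q Ω g}) from
    ⟨h.1.1.inter_of_Gδ h.1.2 h.2.2 h.2.1, h.1.2.inter h.2.2⟩
  rcases eq_or_ne q ∞ with rfl | hqt
  · have H : ∀ w ∈ frontier (Ω : Set ℂ), ∃ h : BergmanInter Ω P,
        Tendsto (fun z => ‖h z‖) (𝓝[Ω] w) atTop := fun w hw => by
      obtain ⟨ζ, hζ, hseg⟩ := hΩ.exists_segment_subset_compl hw
      exact exists_tendsto_norm_atTop_of_segment hb P hζ hseg
    refine ⟨dense_isGδ_totallyUnbounded hb H, dense_isGδ_nowhereLocallyBergman hb fun w hw => ?_⟩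
    obtain ⟨h, hh⟩ := H w hw
    exact ⟨h, fun ε hε => not_memLp_top_of_tendsto hw hh hε⟩
  · have hcomp := fun ζ hζ => hΩ.connectedComponentIn_diff_nonempty (w := ζ) hζ
    refine ⟨dense_isGδ_totallyUnbounded_of_connectedComponentIn hb hcomp hq hqt,
      dense_isGδ_nowhereLocallyBergman hb fun w hw => ?_⟩
    obtain ⟨ζ, hζ, hne⟩ := hcomp w hw
    obtain ⟨v, η, hη, -, hev⟩ := hΩ.exists_cone hw
    obtain ⟨h, hh⟩ := exists_norm_eq_rpow hb P hq hqt (notMem_of_mem_frontier hw) hζ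
    exact ⟨h, fun ε hε => not_memLp_of_norm_eq_rpow hq hqt hη (hev.mono fun t ht => ht.1) hne hh hε⟩

end BergmanInter

end

theorem theorem10 :
    (∀ Ω : Opens ℂ, Bornology.IsBounded (Ω : Set ℂ) → ∀ P : ExponentSeq 2,
      Dense {g : BergmanInter Ω P | TotallyUnbounded Ω g} ∧
      IsGδ {g : BergmanInter Ω P | TotallyUnbounded Ω g}) ∧
    (∀ Ω : Opens ℂ, Bornology.IsBounded (Ω : Set ℂ) →
      (∀ ζ ∈ frontier (Ω : Set ℂ), (connectedComponentIn (Ω : Set ℂ)ᶜ ζ \ {ζ}).Nonempty) →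
      ∀ q : ℝ≥0∞, 1 < q → q < ∞ → ∀ P : ExponentSeq q,
        Dense {g : BergmanInter Ω P | TotallyUnbounded Ω g} ∧
        IsGδ {g : BergmanInter Ω P | TotallyUnbounded Ω g}) ∧
    (∀ Ω : Opens ℂ, Bornology.IsBounded (Ω : Set ℂ) → HasC1Boundary Ω →
      ∀ q : ℝ≥0∞, 1 < q → q ≤ ∞ → ∀ P : ExponentSeq q,
        Dense {g : BergmanInter Ω P | TotallyUnbounded Ω g ∧ NowhereLocallyBergman q Ω g} ∧
        IsGδ {g : BergmanInter Ω P | TotallyUnbounded Ω g ∧ NowhereLocallyBergman q Ω g}) := by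
  refine ⟨fun Ω hb P => ?_, fun Ω hb hΩ q hq hqt P => ?_, fun Ω hb hΩ q hq _ P => ?_⟩
  · exact BergmanInter.dense_isGδ_totallyUnbounded hb fun w hw =>
      BergmanInter.exists_tendsto_norm_atTop_of_two hb P (notMem_of_mem_frontier hw)
  · exact BergmanInter.dense_isGδ_totallyUnbounded_of_connectedComponentIn hb hΩ hq hqt.ne
  · exact BergmanInter.dense_isGδ_of_hasC1Boundary hb hΩ hq
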